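/- A matroid-constrained matching instance consists of a finite bipartite graph $G=(A\cup O,E)$ with a set $A$ of agents and a set $O$ of objects, for each agent $a$ a strict linear order $\succ_a$ on the objects adjacent to $a$, and a matroid $(O,\mathcal I)$. An $\mathcal I$-constrained matching is a matching $M\subseteq E$ whose set of matched objects is in $\mathcal I$. Write $M(a)$ for the object matched to $a$ in $M$, with $M(a)=\emptyset$ if $a$ is unmatched, and $M\succ_a N$ if $M(a)\succ_a N(a)$, where $o\succ_a\emptyset$ for every object $o$ adjacent to $a$. A set $\mathcal M$ of $\mathcal I$-constrained matchings is strongly popular (Condorcet-winning) if $$|\{a\in A:\exists M\in\mathcal M,\ M\succ_a N\}|>|\{a\in A:\forall M\in\mathcal M,\ N\succ_a M\}|$$ for every $\mathcal I$-constrained matching $N$ with $\mathcal M\neq\{N\}$. (So a singleton $\{M\}$ is strongly popular if and only if $M$ is a Condorcet winner, i.e. beats every other $N$, while a set with at least two members must satisfy the inequality for all $N$, its own members included.) A top-choice matching is an $\mathcal I$-constrained matching $T$ such that there are no agent $a$ and no $\mathcal I$-constrained matching $N$ with $N\succ_a T$. **Corollary.** Every matroid-constrained matching instance in which all preferences are strict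 linear orders has a strongly popular set of at most two $\mathcal I$-constrained matchings. Moreover, there is an algorithm that, given the graph, the preferences, and an independence oracle for $\mathcal I$, computes such a set in time polynomial in $|A|+|O|$; the algorithm also reports whether a top-choice matching exists, and if one exists, the set it returns consists of a top-choice matching alone. (Time is measured on a unit-cost random access machine with addition, truncated subtraction and comparison, on which an oracle call is one step.) -/

import Mathlib

/-! ### Matroid-constrained matching instances and their alternatives -/

/-- A matroid-constrained matching instance: a bipartite graph with agents `A`, objects `O` and edge
set `edges`, for each agent `a` a relation `pref a` (`pref a x y` means that `a` strictly prefers `x`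
to `y`; only its values on objects adjacent to `a` matter), and a matroid on the set of all objects. -/
structure MatchingInstance (A O : Type*) where
  edges : Set (A × O)
  pref : A → O → O → Prop
  matroid : Matroid O
  ground_eq : matroid.E = Set.univ

namespace MatchingInstance

variable {A O : Type*}

/-- Every agent strictly and linearly ranks the objects adjacent to it. -/
structure StrictRankings (I : MatchingInstance A O) : Prop where
  irrefl : ∀ a x, (a, x) ∈ I.edges → ¬ I.pref a x x
  asymm : ∀ a x y, (a, x) ∈ I.edges → (a, y) ∈ I.edges → I.pref a x y → ¬ I.pref a y x
  trans : ∀ a x y z, (a, x) ∈ I.edges → (a, y) ∈ I.edges → (a, z) ∈ I.edges →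
    I.pref a x y → I.pref a y z → I.pref a x z
  total : ∀ a x y, (a, x) ∈ I.edges → (a, y) ∈ I.edges → x ≠ y → I.pref a x y ∨ I.pref a y x

/-- A matching: a set of edges such that every agent and every object is on at most one of them. -/
structure IsMatching (I : MatchingInstance A O) (M : Set (A × O)) : Prop where
  subset : M ⊆ I.edges
  agent_unique : ∀ a x y, (a, x) ∈ M → (a, y) ∈ M → x = y
  object_unique : ∀ a b x, (a, x) ∈ M → (b, x) ∈ M → a = b

/-- The set of objects matched by `M`. -/
def matchedObjects (M : Set (A × O)) : Set O := {x | ∃ a, (a, x) ∈ M}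

/-- The alternatives: the matchings whose set of matched objects is independent in the matroid. -/
def alternatives (I : MatchingInstance A O) : Set (Set (A × O)) :=
  {M | I.IsMatching M ∧ I.matroid.Indep (matchedObjects M)}

/-- Agent `a` strictly prefers the matching `M` to the matching `N`: it has an object in `M`, and
either it is unmatched in `N` or it prefers its object in `M` to its object in `N`. -/
def Prefers (I : MatchingInstance A O) (a : A) (M N : Set (A × O)) : Prop :=
  ∃ x, (a, x) ∈ M ∧ ∀ y, (a, y) ∈ N → I.pref a x y

/-- The number of agents that prefer some member of `S` to `Z`. -/
noncomputable def votesForSet (I : MatchingInstance A O) (S : Set (Set (A × O)))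
    (Z : Set (A × O)) : ℕ :=
  Set.ncard {a | ∃ Y ∈ S, I.Prefers a Y Z}

/-- The number of agents that prefer `Z` to every member of `S`. -/
noncomputable def votesAgainstSet (I : MatchingInstance A O) (S : Set (Set (A × O)))
    (Z : Set (A × O)) : ℕ :=
  Set.ncard {a | ∀ Y ∈ S, I.Prefers a Z Y}

/-- The margin of `S` over `Z`. -/
noncomputable def margin (I : MatchingInstance A O) (S : Set (Set (A × O)))
    (Z : Set (A × O)) : ℤ :=
  (I.votesForSet S Z : ℤ) - (I.votesAgainstSet S Z : ℤ)

/-- `S` is strongly popular (Condorcet-winning): a set of alternatives with a positive margin over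
every alternative `Z`. The only exception is that a singleton is not compared with its own member
(where the margin is always zero), so that `{M}` is strongly popular exactly if `M` is a Condorcet
winner; a set with two or more members has to beat its own members, too. -/
def IsStronglyPopular (I : MatchingInstance A O) (S : Set (Set (A × O))) : Prop :=
  S ⊆ I.alternatives ∧ ∀ Z ∈ I.alternatives, S ≠ {Z} → 0 < I.margin S Z

/-- A top-choice alternative: no agent prefers another alternative to it. -/
def IsTopChoice (I : MatchingInstance A O) (T : Set (A × O)) : Prop :=
  T ∈ I.alternatives ∧ ∀ a, ∀ Y ∈ I.alternatives, ¬ I.Prefers a Y T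

end MatchingInstance

/-! ### Random access machines with an oracle

Programs work on finitely many arrays of natural numbers (only the array names that occur in the
program are ever used), with indirect addressing. Arithmetic is restricted to addition, truncated
subtraction and comparison, so that a run of `t` steps produces only numbers of `O(t)` more bits than
those it starts from; hence polynomial time for unit costs is polynomial time on Turing machines. -/

namespace OracleRAM

/-- The memory: `s k i` is the content of cell `i` of array `k`. -/
abbrev Memory := ℕ → ℕ → ℕ

/-- The memory `s` after writing `v` into cell `i` of array `k`. -/
def Memory.write (s : Memory) (k i v : ℕ) : Memory :=
  fun k' i' => if k' = k ∧ i' = i then v else s k' i'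

/-- Expressions; `cell k e` is the content of cell number `e` of array `k`, and `lt`, `eq` have the
values `1` (true) and `0` (false). -/
inductive Expr where
  | const (c : ℕ)
  | cell (k : ℕ) (e : Expr)
  | add (e f : Expr)
  | sub (e f : Expr)
  | lt (e f : Expr)
  | eq (e f : Expr)

/-- The value of an expression. -/
def Expr.eval (s : Memory) : Expr → ℕ
  | .const c => c
  | .cell k e => s k (e.eval s)
  | .add e f => e.eval s + f.eval s
  | .sub e f => e.eval s - f.eval s
  | .lt e f => if e.eval s < f.eval s then 1 else 0
  | .eq e f => if e.eval s = f.eval s then 1 else 0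

/-- The time for evaluating an expression: the number of its operations. -/
def Expr.cost : Expr → ℕ
  | .const _ => 1
  | .cell _ e => e.cost + 1
  | .add e f => e.cost + f.cost + 1
  | .sub e f => e.cost + f.cost + 1
  | .lt e f => e.cost + f.cost + 1
  | .eq e f => e.cost + f.cost + 1

/-- Programs. `store k e f` writes the value of `f` into cell number `e` of array `k`. `query k r`
asks the oracle about the set of the positions of the nonzero cells of array `k` and writes the answer
(`1` for yes, `0` for no) into cell `0` of array `r`. -/
inductive Program where
  | skip
  | store (k : ℕ) (e f : Expr)
  | query (k r : ℕ)
  | seq (p q : Program)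
  | cond (b : Expr) (p q : Program)
  | loop (b : Expr) (p : Program)

/-- `Run Ω p s t s'`: with oracle `Ω`, the program `p`, started on the memory `s`, halts after `t`
steps with the memory `s'`. -/
inductive Run (Ω : Set ℕ → Prop) : Program → Memory → ℕ → Memory → Prop where
  | skip (s : Memory) : Run Ω .skip s 1 s
  | store (k : ℕ) (e f : Expr) (s : Memory) :
      Run Ω (.store k e f) s (e.cost + f.cost + 1) (s.write k (e.eval s) (f.eval s))
  | query_yes (k r : ℕ) (s : Memory) (h : Ω {i | s k i ≠ 0}) :
      Run Ω (.query k r) s 1 (s.write r 0 1)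
  | query_no (k r : ℕ) (s : Memory) (h : ¬ Ω {i | s k i ≠ 0}) :
      Run Ω (.query k r) s 1 (s.write r 0 0)
  | seq {p q : Program} {s s' s'' : Memory} {t t' : ℕ}
      (hp : Run Ω p s t s') (hq : Run Ω q s' t' s'') : Run Ω (.seq p q) s (t + t') s''
  | cond_true {b : Expr} {p : Program} (q : Program) {s s' : Memory} {t : ℕ}
      (hb : b.eval s ≠ 0) (hp : Run Ω p s t s') : Run Ω (.cond b p q) s (b.cost + t + 1) s'
  | cond_false {b : Expr} (p : Program) {q : Program} {s s' : Memory} {t : ℕ}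
      (hb : b.eval s = 0) (hq : Run Ω q s t s') : Run Ω (.cond b p q) s (b.cost + t + 1) s'
  | loop_true {b : Expr} {p : Program} {s s' s'' : Memory} {t t' : ℕ}
      (hb : b.eval s ≠ 0) (hp : Run Ω p s t s') (hl : Run Ω (.loop b p) s' t' s'') :
      Run Ω (.loop b p) s (b.cost + t + t' + 1) s''
  | loop_false {b : Expr} (p : Program) {s : Memory} (hb : b.eval s = 0) :
      Run Ω (.loop b p) s (b.cost + 1) s

end OracleRAM

/-! ### Input, independence oracle and output -/

namespace MatchingInstance

variable {n m : ℕ}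

/-- The independence oracle of the matroid: a set of numbers stands for the objects in it. -/
def oracle (I : MatchingInstance (Fin n) (Fin m)) : Set ℕ → Prop :=
  fun Q => I.matroid.Indep {x : Fin m | (x : ℕ) ∈ Q}

open Classical in
/-- The input: array `0` begins with the numbers `n` of agents and `m` of objects, array `1` holds the
adjacency table of the graph, row by row (cell `a * m + x` for agent `a` and object `x`), and array `2`
holds the table of the preference relations on adjacent objects (cell `(a * m + x) * m + y` is `1` if
agent `a` prefers `x` to `y`). All other cells are `0`. The matroid is not part of the input. -/
noncomputable def input (I : MatchingInstance (Fin n) (Fin m)) : OracleRAM.Memory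
  | 0, 0 => n
  | 0, 1 => m
  | 1, i => if ∃ (a : Fin n) (x : Fin m), i = a * m + x ∧ (a, x) ∈ I.edges then 1 else 0
  | 2, i => if ∃ (a : Fin n) (x y : Fin m), i = (a * m + x) * m + y ∧
      (a, x) ∈ I.edges ∧ (a, y) ∈ I.edges ∧ I.pref a x y then 1 else 0
  | _, _ => 0

/-- Array `k` of the memory `s` represents the matching `M`: cell `a` is `x + 1` if agent `a` is
matched to object `x`, and `0` if agent `a` is unmatched. -/
def Represents (s : OracleRAM.Memory) (k : ℕ) (M : Set (Fin n × Fin m)) : Prop :=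
  ∀ a : Fin n, (∀ x : Fin m, (a, x) ∈ M ↔ s k a = x + 1) ∧ ((∀ x : Fin m, (a, x) ∉ M) ↔ s k a = 0)

end MatchingInstance

/-! Serve the agents in a fixed order and build two alternatives `M₁`, `M₂`, initially empty. Each
agent takes its best object that extends at least one of them, which is added to `M₁` if possible
and otherwise to `M₂`. Hence no agent is matched in both, an object an agent likes better than what
it gets was already spanned by both alternatives at its turn, and every object put into `M₂` was
then spanned by `M₁`. `IsGreedy` records exactly this.

If `M₂` stays empty, anything an agent would prefer is a loop, so `M₁` is a top-choice alternative
and, by strictness, a Condorcet winner. Conversely, a top-choice alternative forces `M₂ = ∅`: up to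
the first entry of `M₂` it would have to agree with the greedy choices, and that entry is spanned by
earlier objects of `M₁`.

If `M₂` is nonempty, let `N` be any alternative, `W` the agents that prefer `N` to both, and `F`
those that prefer one of the two to `N`. Restrict to the agents before the last member of `W`: let
`r₁`, `r₂` count those matched in `M₁`, `M₂`, and `K₁`, `K₂` those who get the same object in `N`.
The objects that `N` gives to `W`, `K₁`, `K₂` are independent and spanned by the restricted `M₁`, so
`|W| + |K₁| + |K₂| ≤ r₁`; likewise `|W| ≤ r₂`. Every agent counted by `r₁ + r₂` lies in `K₁`, `K₂`,
`F` or in `W` minus its last member. Together, `|F| > r₂ ≥ |W|`. If `W` is empty, no restriction is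
needed and `|F| ≥ |M₂| > 0`. This is `IsGreedy.counting` and `IsGreedy.margin_pos`.

The greedy rule needs only independence tests. The program scans all objects for each agent, and
loop invariants (`Scans`, `Serves`) tie its memory to a greedy pair. -/

namespace MatchingInstance

variable {A O : Type*}

/-! ### Spans of alternatives and greedy pairs -/

/-- The agents that are matched in `M`. -/
def matchedAgents (M : Set (A × O)) : Set A := {a | ∃ x, (a, x) ∈ M}

/-- The part of `M` on the agents in positions before `k`. -/
def before (pos : A → ℕ) (k : ℕ) (M : Set (A × O)) : Set (A × O) := {e ∈ M | pos e.1 < k}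

/-- The objects spanned by the objects matched in `M`. -/
def spanned (I : MatchingInstance A O) (M : Set (A × O)) : Set O :=
  I.matroid.closure (matchedObjects M)

/-- The pairs of alternatives that arise when the agents in positions before `k` choose in turn their
best object that extends one of two alternatives, which then extends `M₁` if possible and
otherwise `M₂`. -/
structure IsGreedy (I : MatchingInstance A O) (pos : A → ℕ) (k : ℕ) (M₁ M₂ : Set (A × O)) :
    Prop where
  left_mem : M₁ ∈ I.alternatives
  right_mem : M₂ ∈ I.alternatives
  lt_left : ∀ a x, (a, x) ∈ M₁ → pos a < k
  lt_right : ∀ a x, (a, x) ∈ M₂ → pos a < k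
  disjoint : ∀ a x y, (a, x) ∈ M₁ → (a, y) ∉ M₂
  best_left : ∀ a x, pos a < k → (a, x) ∈ I.edges → x ∉ I.spanned (before pos (pos a) M₁) →
    ∃ y, (a, y) ∈ M₁ ∪ M₂ ∧ (y = x ∨ I.pref a y x)
  best_right : ∀ a x, pos a < k → (a, x) ∈ I.edges → x ∉ I.spanned (before pos (pos a) M₂) →
    ∃ y, (a, y) ∈ M₁ ∪ M₂ ∧ (y = x ∨ I.pref a y x)
  right_spanned : ∀ a x, (a, x) ∈ M₂ → x ∈ I.spanned (before pos (pos a) M₁)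

theorem matchedObjects_mono {M N : Set (A × O)} (h : M ⊆ N) :
    matchedObjects M ⊆ matchedObjects N := fun _ ⟨a, ha⟩ => ⟨a, h ha⟩

theorem before_mono (pos : A → ℕ) {k l : ℕ} (h : k ≤ l) (M : Set (A × O)) :
    before pos k M ⊆ before pos l M := fun _ he => ⟨he.1, he.2.trans_le h⟩

theorem before_insert (pos : A → ℕ) {k : ℕ} {a : A} (h : k ≤ pos a) (x : O) (M : Set (A × O)) :
    before pos k (insert (a, x) M) = before pos k M := by
  ext ⟨b, y⟩
  simp only [before, Set.mem_insert_iff, Prod.mk.injEq, Set.mem_ofPred_eq]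
  constructor
  · rintro ⟨⟨rfl, rfl⟩ | h1, h2⟩
    · omega
    · exact ⟨h1, h2⟩
  · exact fun h1 => ⟨Or.inr h1.1, h1.2⟩

theorem before_eq_self {pos : A → ℕ} {k : ℕ} {M : Set (A × O)} (h : ∀ a x, (a, x) ∈ M → pos a < k) :
    before pos k M = M := by
  ext ⟨b, y⟩
  exact ⟨fun h1 => h1.1, fun h1 => ⟨h1, h _ _ h1⟩⟩

theorem matchedObjects_insert (a : A) (x : O) (M : Set (A × O)) :
    matchedObjects (insert (a, x) M) = insert x (matchedObjects M) := by
  ext y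
  simp only [matchedObjects, Set.mem_insert_iff, Prod.mk.injEq, Set.mem_ofPred_eq]
  constructor
  · rintro ⟨b, ⟨rfl, rfl⟩ | h⟩
    exacts [Or.inl rfl, Or.inr ⟨b, h⟩]
  · rintro (rfl | ⟨b, h⟩)
    exacts [⟨a, Or.inl ⟨rfl, rfl⟩⟩, ⟨b, Or.inr h⟩]

theorem spanned_mono (I : MatchingInstance A O) {M N : Set (A × O)} (h : M ⊆ N) :
    I.spanned M ⊆ I.spanned N := I.matroid.closure_mono (matchedObjects_mono h)

theorem mem_spanned (I : MatchingInstance A O) {M : Set (A × O)} {a : A} {x : O}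
    (h : (a, x) ∈ M) : x ∈ I.spanned M :=
  I.matroid.mem_closure_of_mem' ⟨a, h⟩ (I.ground_eq ▸ Set.mem_univ x)

/-- Links the span, in which the mathematics is phrased, to the question that an independence oracle
can answer. -/
theorem notMem_spanned_iff (I : MatchingInstance A O) {M : Set (A × O)} (hM : M ∈ I.alternatives)
    (x : O) : x ∉ I.spanned M ↔
      I.matroid.Indep (insert x (matchedObjects M)) ∧ x ∉ matchedObjects M :=
  hM.2.notMem_closure_iff (I.ground_eq ▸ Set.mem_univ x)

theorem empty_mem_alternatives (I : MatchingInstance A O) : ∅ ∈ I.alternatives := by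
  refine ⟨⟨Set.empty_subset _, by simp, by simp⟩, ?_⟩
  convert I.matroid.empty_indep
  ext; simp [matchedObjects]

theorem insert_mem_alternatives (I : MatchingInstance A O) {M : Set (A × O)}
    (hM : M ∈ I.alternatives) {a : A} {x : O} (ha : ∀ y, (a, y) ∉ M) (hax : (a, x) ∈ I.edges)
    (hx : x ∉ I.spanned M) : insert (a, x) M ∈ I.alternatives := by
  obtain ⟨hi, hn⟩ := (I.notMem_spanned_iff hM x).1 hx
  refine ⟨⟨Set.insert_subset hax hM.1.subset, ?_, ?_⟩, by rwa [matchedObjects_insert]⟩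
  · intro b y z hy hz
    simp only [Set.mem_insert_iff, Prod.mk.injEq] at hy hz
    rcases hy with ⟨rfl, rfl⟩ | hy <;> rcases hz with ⟨h1, rfl⟩ | hz
    · rfl
    · exact absurd hz (ha _)
    · exact absurd (h1 ▸ hy) (ha _)
    · exact hM.1.agent_unique _ _ _ hy hz
  · intro b c y hy hz
    simp only [Set.mem_insert_iff, Prod.mk.injEq] at hy hz
    rcases hy with ⟨rfl, rfl⟩ | hy <;> rcases hz with ⟨rfl, h1⟩ | hz
    · rfl
    · exact absurd ⟨_, hz⟩ hn
    · exact absurd ⟨_, h1 ▸ hy⟩ hn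
    · exact hM.1.object_unique _ _ _ hy hz

/-- An object of an alternative is not a loop. -/
theorem notMem_spanned_empty (I : MatchingInstance A O) {M : Set (A × O)} (hM : M ∈ I.alternatives)
    {a : A} {x : O} (h : (a, x) ∈ M) : x ∉ I.spanned (∅ : Set (A × O)) := by
  rw [I.notMem_spanned_iff I.empty_mem_alternatives]
  have he : matchedObjects (∅ : Set (A × O)) = ∅ := by ext; simp [matchedObjects]
  rw [he]
  exact ⟨hM.2.subset (by rintro y (rfl | hy); exacts [⟨a, h⟩, hy.elim]), by simp⟩

theorem isGreedy_zero (I : MatchingInstance A O) (pos : A → ℕ) : I.IsGreedy pos 0 ∅ ∅ where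
  left_mem := I.empty_mem_alternatives
  right_mem := I.empty_mem_alternatives
  lt_left := by simp
  lt_right := by simp
  disjoint := by simp
  best_left := by simp
  best_right := by simp
  right_spanned := by simp

/-! ### Extending a greedy pair by one agent -/

namespace IsGreedy

variable {I : MatchingInstance A O} {pos : A → ℕ} {k : ℕ} {M₁ M₂ : Set (A × O)}

/-- The next agent finds no object. -/
theorem step_none (h : I.IsGreedy pos k M₁ M₂) (hpos : pos.Injective) {a : A} (ha : pos a = k)
    (hx : ∀ x, (a, x) ∈ I.edges → x ∈ I.spanned M₁ ∧ x ∈ I.spanned M₂) :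
    I.IsGreedy pos (k + 1) M₁ M₂ where
  left_mem := h.left_mem
  right_mem := h.right_mem
  lt_left b x hb := (h.lt_left b x hb).trans (Nat.lt_succ_self k)
  lt_right b x hb := (h.lt_right b x hb).trans (Nat.lt_succ_self k)
  disjoint := h.disjoint
  best_left b x hb hbx hn := by
    rcases Nat.lt_succ_iff_lt_or_eq.1 hb with hb | hb
    · exact h.best_left b x hb hbx hn
    · obtain rfl := hpos (hb.trans ha.symm)
      rw [hb, before_eq_self h.lt_left] at hn
      exact absurd (hx x hbx).1 hn
  best_right b x hb hbx hn := by
    rcases Nat.lt_succ_iff_lt_or_eq.1 hb with hb | hb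
    · exact h.best_right b x hb hbx hn
    · obtain rfl := hpos (hb.trans ha.symm)
      rw [hb, before_eq_self h.lt_right] at hn
      exact absurd (hx x hbx).2 hn
  right_spanned := h.right_spanned

/-- The next agent gets an object in the first alternative. -/
theorem step_left (h : I.IsGreedy pos k M₁ M₂) (hpos : pos.Injective) {a : A} (ha : pos a = k)
    {x : O} (hax : (a, x) ∈ I.edges) (hx : x ∉ I.spanned M₁)
    (hbest : ∀ y, (a, y) ∈ I.edges → (y ∉ I.spanned M₁ ∨ y ∉ I.spanned M₂) →
      x = y ∨ I.pref a x y) :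
    I.IsGreedy pos (k + 1) (insert (a, x) M₁) M₂ := by
  have h1 : ∀ y, (a, y) ∉ M₁ := fun y hy => by have := h.lt_left _ _ hy; omega
  have h2 : ∀ y, (a, y) ∉ M₂ := fun y hy => by have := h.lt_right _ _ hy; omega
  have hsub : ∀ {b y}, (b, y) ∈ M₁ ∪ M₂ → (b, y) ∈ insert (a, x) M₁ ∪ M₂ := by
    rintro b y (hb | hb)
    exacts [Or.inl (Or.inr hb), Or.inr hb]
  refine ⟨I.insert_mem_alternatives h.left_mem h1 hax hx, h.right_mem, ?_, ?_, ?_, ?_, ?_, ?_⟩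
  · rintro b y (hb | hb)
    · rw [(Prod.mk.inj hb).1]; omega
    · exact (h.lt_left b y hb).trans (Nat.lt_succ_self k)
  · exact fun b y hb => (h.lt_right b y hb).trans (Nat.lt_succ_self k)
  · rintro b y z (hb | hb)
    · rw [(Prod.mk.inj hb).1]; exact h2 z
    · exact h.disjoint b y z hb
  · intro b y hb hby hn
    -- The new edge belongs to the agent in position `k`, so it does not change what `b`, in
    -- position at most `k`, found at its turn.
    rw [before_insert pos (by omega)] at hn
    rcases Nat.lt_succ_iff_lt_or_eq.1 hb with hb | hb
    · obtain ⟨z, hz, hz'⟩ := h.best_left b y hb hby hn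
      exact ⟨z, hsub hz, hz'⟩
    · obtain rfl := hpos (hb.trans ha.symm)
      rw [hb, before_eq_self h.lt_left] at hn
      exact ⟨x, Or.inl (Or.inl rfl), hbest y hby (Or.inl hn)⟩
  · intro b y hb hby hn
    rcases Nat.lt_succ_iff_lt_or_eq.1 hb with hb | hb
    · obtain ⟨z, hz, hz'⟩ := h.best_right b y hb hby hn
      exact ⟨z, hsub hz, hz'⟩
    · obtain rfl := hpos (hb.trans ha.symm)
      rw [hb, before_eq_self h.lt_right] at hn
      exact ⟨x, Or.inl (Or.inl rfl), hbest y hby (Or.inr hn)⟩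
  · intro b y hb
    rw [before_insert pos (by have := h.lt_right b y hb; omega)]
    exact h.right_spanned b y hb

/-- The next agent gets an object in the second alternative. -/
theorem step_right (h : I.IsGreedy pos k M₁ M₂) (hpos : pos.Injective) {a : A} (ha : pos a = k)
    {x : O} (hax : (a, x) ∈ I.edges) (hx₁ : x ∈ I.spanned M₁) (hx : x ∉ I.spanned M₂)
    (hbest : ∀ y, (a, y) ∈ I.edges → (y ∉ I.spanned M₁ ∨ y ∉ I.spanned M₂) →
      x = y ∨ I.pref a x y) :
    I.IsGreedy pos (k + 1) M₁ (insert (a, x) M₂) := by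
  have h1 : ∀ y, (a, y) ∉ M₁ := fun y hy => by have := h.lt_left _ _ hy; omega
  have h2 : ∀ y, (a, y) ∉ M₂ := fun y hy => by have := h.lt_right _ _ hy; omega
  have hsub : ∀ {b y}, (b, y) ∈ M₁ ∪ M₂ → (b, y) ∈ M₁ ∪ insert (a, x) M₂ := by
    rintro b y (hb | hb)
    exacts [Or.inl hb, Or.inr (Or.inr hb)]
  refine ⟨h.left_mem, I.insert_mem_alternatives h.right_mem h2 hax hx, ?_, ?_, ?_, ?_, ?_, ?_⟩
  · exact fun b y hb => (h.lt_left b y hb).trans (Nat.lt_succ_self k)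
  · rintro b y (hb | hb)
    · rw [(Prod.mk.inj hb).1]; omega
    · exact (h.lt_right b y hb).trans (Nat.lt_succ_self k)
  · rintro b y z hb (hz | hz)
    · rw [(Prod.mk.inj hz).1] at hb; exact h1 y hb
    · exact h.disjoint b y z hb hz
  · intro b y hb hby hn
    rcases Nat.lt_succ_iff_lt_or_eq.1 hb with hb | hb
    · obtain ⟨z, hz, hz'⟩ := h.best_left b y hb hby hn
      exact ⟨z, hsub hz, hz'⟩
    · obtain rfl := hpos (hb.trans ha.symm)
      rw [hb, before_eq_self h.lt_left] at hn
      exact ⟨x, Or.inr (Or.inl rfl), hbest y hby (Or.inl hn)⟩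
  · intro b y hb hby hn
    rw [before_insert pos (by omega)] at hn
    rcases Nat.lt_succ_iff_lt_or_eq.1 hb with hb | hb
    · obtain ⟨z, hz, hz'⟩ := h.best_right b y hb hby hn
      exact ⟨z, hsub hz, hz'⟩
    · obtain rfl := hpos (hb.trans ha.symm)
      rw [hb, before_eq_self h.lt_right] at hn
      exact ⟨x, Or.inr (Or.inl rfl), hbest y hby (Or.inr hn)⟩
  · rintro b y (hb | hb)
    · obtain ⟨rfl, rfl⟩ := Prod.mk.inj hb
      rwa [ha, before_eq_self h.lt_left]
    · exact h.right_spanned b y hb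

end IsGreedy

/-- A nonempty finite set of objects acceptable to an agent with strict rankings has a best member. -/
theorem StrictRankings.exists_best {I : MatchingInstance A O} (hI : I.StrictRankings) (a : A)
    {S : Set O} (hfin : S.Finite) (hS : S.Nonempty) (hadj : ∀ x ∈ S, (a, x) ∈ I.edges) :
    ∃ x ∈ S, ∀ y ∈ S, x = y ∨ I.pref a x y := by
  induction S, hfin using Set.Finite.induction_on with
  | empty => exact absurd hS Set.not_nonempty_empty
  | @insert z S hz hfin ih =>
    rcases S.eq_empty_or_nonempty with rfl | hS
    · exact ⟨z, Or.inl rfl, by rintro y (rfl | hy); exacts [Or.inl rfl, hy.elim]⟩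
    replace ih := ih hS
    obtain ⟨x, hx, hbest⟩ := ih fun y hy => hadj y (Or.inr hy)
    have hax := hadj x (Or.inr hx)
    have haz := hadj z (Or.inl rfl)
    rcases hI.total a x z hax haz (fun h => hz (h ▸ hx)) with h | h
    · refine ⟨x, Or.inr hx, ?_⟩
      rintro y (rfl | hy)
      exacts [Or.inr h, hbest y hy]
    · refine ⟨z, Or.inl rfl, ?_⟩
      rintro y (rfl | hy)
      · exact Or.inl rfl
      · rcases hbest y hy with rfl | hxy
        · exact Or.inr h
        · exact Or.inr (hI.trans a z x y haz hax (hadj y (Or.inr hy)) h hxy)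

theorem exists_isGreedy [Finite O] {I : MatchingInstance A O} (hI : I.StrictRankings) {pos : A → ℕ}
    (hpos : pos.Injective) (k : ℕ) (hk : ∀ i < k, ∃ a, pos a = i) :
    ∃ M₁ M₂, I.IsGreedy pos k M₁ M₂ := by
  induction k with
  | zero => exact ⟨∅, ∅, I.isGreedy_zero pos⟩
  | succ k ih =>
    obtain ⟨M₁, M₂, h⟩ := ih fun i hi => hk i (by omega)
    obtain ⟨a, ha⟩ := hk k (by omega)
    let S : Set O := {x | (a, x) ∈ I.edges ∧ (x ∉ I.spanned M₁ ∨ x ∉ I.spanned M₂)}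
    rcases S.eq_empty_or_nonempty with hS | hS
    · refine ⟨M₁, M₂, h.step_none hpos ha fun x hx => ?_⟩
      by_contra hn
      exact Set.eq_empty_iff_forall_notMem.1 hS x ⟨hx, by tauto⟩
    · obtain ⟨x, hx, hbest⟩ := hI.exists_best a S.toFinite hS fun x hx => hx.1
      by_cases h1 : x ∈ I.spanned M₁
      · exact ⟨_, _, h.step_right hpos ha hx.1 h1 (by have := hx.2; tauto)
          fun y hy hy' => hbest y ⟨hy, hy'⟩⟩
      · exact ⟨_, _, h.step_left hpos ha hx.1 h1 fun y hy hy' => hbest y ⟨hy, hy'⟩⟩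

/-- A rank bound: `N` gives the agents in `D` distinct objects that form an independent set inside
the closure of the objects of `M`, and that closure has rank at most the size of `M`. -/
theorem ncard_le_of_subset_spanned [Finite A] [Finite O] {I : MatchingInstance A O}
    {M N : Set (A × O)} (hM : I.IsMatching M) (hN : N ∈ I.alternatives) {D : Set A}
    (hD : ∀ a ∈ D, ∃ x, (a, x) ∈ N ∧ x ∈ I.spanned M) : D.ncard ≤ (matchedAgents M).ncard := by
  rcases D.eq_empty_or_nonempty with rfl | ⟨a₀, ha₀⟩
  · simp
  -- `choose!` needs inhabited types for its default values outside `D` and outside the matched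
  -- objects.
  have : Nonempty A := ⟨a₀⟩
  have : Nonempty O := ⟨(hD a₀ ha₀).choose⟩
  choose! f hf using hD
  choose! g hg using fun x (hx : x ∈ matchedObjects M) => hx
  have h1 : D.ncard = (f '' D).ncard := by
    refine (Set.InjOn.ncard_image fun a ha b hb hab => ?_).symm
    exact hN.1.object_unique _ _ _ (hf a ha).1 (hab ▸ (hf b hb).1)
  have h2 : (matchedObjects M).ncard ≤ (matchedAgents M).ncard := by
    refine Set.ncard_le_ncard_of_injOn g (fun x hx => ⟨x, hg x hx⟩) (fun x hx y hy hxy => ?_)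
    exact hM.agent_unique _ _ _ (hg x hx) (hxy ▸ hg y hy)
  have hind : I.matroid.Indep (f '' D) :=
    hN.2.subset (by rintro _ ⟨a, ha, rfl⟩; exact ⟨a, (hf a ha).1⟩)
  have hsub : f '' D ⊆ I.matroid.closure (matchedObjects M) := by
    rintro _ ⟨a, ha, rfl⟩; exact (hf a ha).2
  have h3 : (f '' D).encard ≤ (matchedObjects M).encard := by
    rw [← hind.eRk_eq_encard]
    exact (I.matroid.eRk_mono hsub).trans
      ((I.matroid.eRk_closure_eq _).trans_le (I.matroid.eRk_le_encard _))
  rw [h1]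
  refine le_trans ?_ h2
  rw [← (Set.toFinite _).cast_ncard_eq, ← (Set.toFinite (matchedObjects M)).cast_ncard_eq] at h3
  exact_mod_cast h3

end MatchingInstance
-- Top-choice alternatives and strong popularity
namespace MatchingInstance

variable {A O : Type*}

namespace IsGreedy

variable {I : MatchingInstance A O} {pos : A → ℕ} {k : ℕ} {M₁ M₂ : Set (A × O)}

theorem pos_lt_of_mem (h : I.IsGreedy pos k M₁ M₂) {a : A} {x : O} (hx : (a, x) ∈ M₁ ∪ M₂) :
    pos a < k :=
  hx.elim (h.lt_left a x) (h.lt_right a x)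

theorem mem_edges (h : I.IsGreedy pos k M₁ M₂) {a : A} {x : O} (hx : (a, x) ∈ M₁ ∪ M₂) :
    (a, x) ∈ I.edges :=
  hx.elim (fun h' => h.left_mem.1.subset h') (fun h' => h.right_mem.1.subset h')

/-- An object that an agent prefers to what it gets is spanned by both alternatives. -/
theorem spanned_of_prefers (h : I.IsGreedy pos k M₁ M₂) (hI : I.StrictRankings)
    {a : A} (ha : pos a < k) {x : O} (hax : (a, x) ∈ I.edges)
    (hx : ∀ y, (a, y) ∈ M₁ ∪ M₂ → I.pref a x y) :
    x ∈ I.spanned (before pos (pos a) M₁) ∧ x ∈ I.spanned (before pos (pos a) M₂) := by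
  have key : ¬ ∃ y, (a, y) ∈ M₁ ∪ M₂ ∧ (y = x ∨ I.pref a y x) := by
    rintro ⟨y, hy, rfl | hyx⟩
    · exact hI.irrefl a y hax (hx y hy)
    · exact hI.asymm a x y hax (h.mem_edges hy) (hx y hy) hyx
  constructor <;> by_contra hn
  exacts [key (h.best_left a x ha hax hn), key (h.best_right a x ha hax hn)]

/-- An object preferred to the greedy choice is spanned by the empty second alternative, hence a
loop, and no alternative contains a loop. -/
theorem isTopChoice_of_right_eq_empty (h : I.IsGreedy pos k M₁ M₂) (hI : I.StrictRankings)
    (hk : ∀ a, pos a < k) (h₂ : M₂ = ∅) : I.IsTopChoice M₁ := by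
  subst h₂
  refine ⟨h.left_mem, fun a Y hY ⟨x, hx, hp⟩ => ?_⟩
  have := (h.spanned_of_prefers hI (hk a) (hY.1.subset hx) (by simpa using hp)).2
  exact I.notMem_spanned_empty hY hx (by simpa [before] using this)

/-- Induction on positions: as long as `M₂` is empty, only loops are excluded from extending it, so
the greedy choices coincide with those of `T`. A first entry of `M₂` would then make the objects of
`T` dependent. -/
theorem right_eq_empty_of_isTopChoice (h : I.IsGreedy pos k M₁ M₂) {T : Set (A × O)} (hT : I.IsTopChoice T) : M₂ = ∅ := by
  have hbefore : ∀ i, ∀ b y, (b, y) ∈ before pos i M₂ → False := by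
    intro i
    induction i with
    | zero => rintro b y ⟨-, hb⟩; exact Nat.not_lt_zero _ hb
    | succ i ih =>
      -- an agent in position at most `i` gets the same in `T`
      have hsame : ∀ b y, pos b ≤ i → (b, y) ∈ M₁ ∪ M₂ → (b, y) ∈ T := by
        intro b y hb hy
        have hyT : ¬ I.Prefers b M₁ T ∧ ¬ I.Prefers b M₂ T :=
          ⟨hT.2 b M₁ h.left_mem, hT.2 b M₂ h.right_mem⟩
        obtain ⟨z, hz, hyz⟩ : ∃ z, (b, z) ∈ T ∧ ¬ I.pref b y z := by
          by_contra! hn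
          rcases hy with hy | hy
          exacts [hyT.1 ⟨y, hy, hn⟩, hyT.2 ⟨y, hy, hn⟩]
        have hemp : before pos (pos b) M₂ = ∅ := by
          refine Set.eq_empty_iff_forall_notMem.2 fun e he => ih e.1 e.2 ?_
          exact before_mono pos hb _ he
        -- The object `z` that `b` gets in `T` is not a loop, so it extended the still empty `M₂`
        -- and the greedy choice is at least as good; `hyz` rules out that it is better.
        obtain ⟨u, hu, huz⟩ := h.best_right b z (h.pos_lt_of_mem hy) (hT.1.1.subset hz)
          (by rw [hemp]; exact I.notMem_spanned_empty hT.1 hz)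
        have huy : u = y := by
          rcases hu with hu | hu <;> rcases hy with hy | hy
          · exact h.left_mem.1.agent_unique _ _ _ hu hy
          · exact absurd hy (h.disjoint _ _ _ hu)
          · exact absurd hu (h.disjoint _ _ _ hy)
          · exact h.right_mem.1.agent_unique _ _ _ hu hy
        subst huy
        rcases huz with rfl | huz
        exacts [hz, absurd huz hyz]
      rintro b y ⟨hb, hbi⟩
      have hy := h.right_spanned b y hb
      have hbT := hsame b y (Nat.lt_succ_iff.1 hbi) (Or.inr hb)
      have hsub : insert (b, y) (before pos (pos b) M₁) ⊆ T := by
        rintro ⟨c, z⟩ (hc | hc)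
        · exact hc ▸ hbT
        · exact hsame c z (hc.2.le.trans (Nat.lt_succ_iff.1 hbi)) (Or.inl hc.1)
      have hind : I.matroid.Indep (insert y (matchedObjects (before pos (pos b) M₁))) := by
        rw [← matchedObjects_insert b]
        exact hT.1.2.subset (matchedObjects_mono hsub)
      -- Spanned by an independent set and yet independent together with it, `y` must itself be
      -- matched in the earlier part of `M₁`. Its owner there is `b`, which is not before itself.
      have hmem := (hind.subset (Set.subset_insert _ _)).mem_closure_iff'.1 hy
      obtain ⟨c, hc⟩ := hmem.2 hind
      have := hT.1.1.object_unique _ _ _ hbT (hsub (Or.inr hc))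
      subst this
      exact lt_irrefl _ hc.2
  refine Set.eq_empty_iff_forall_notMem.2 fun e he => hbefore (pos e.1 + 1) e.1 e.2 ⟨he, ?_⟩
  exact Nat.lt_succ_self _

variable [Finite A] [Finite O]

/-- Counting in the part of the greedy pair on the agents in positions before `l`, if it spans the
objects of all agents that prefer `N`. -/
theorem counting (h : I.IsGreedy pos k M₁ M₂) (hI : I.StrictRankings) {N : Set (A × O)}
    (hN : N ∈ I.alternatives) (l : ℕ)
    (hW : ∀ a, (∀ Y ∈ ({M₁, M₂} : Set _), I.Prefers a N Y) →
      ∃ x, (a, x) ∈ N ∧ x ∈ I.spanned (before pos l M₁) ∧ x ∈ I.spanned (before pos l M₂)) :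
    I.votesAgainstSet {M₁, M₂} N + (matchedAgents (before pos l M₂)).ncard ≤
      I.votesForSet {M₁, M₂} N +
        ({a | ∀ Y ∈ ({M₁, M₂} : Set _), I.Prefers a N Y} ∩ {a | pos a < l}).ncard ∧
    I.votesAgainstSet {M₁, M₂} N ≤ (matchedAgents (before pos l M₂)).ncard := by
  unfold votesAgainstSet votesForSet
  set W : Set A := {a | ∀ Y ∈ ({M₁, M₂} : Set _), I.Prefers a N Y} with hWdef
  set F : Set A := {a | ∃ Y ∈ ({M₁, M₂} : Set _), I.Prefers a Y N} with hFdef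
  set K₁ : Set A := matchedAgents (before pos l (M₁ ∩ N)) with hK₁
  set K₂ : Set A := matchedAgents (before pos l (M₂ ∩ N)) with hK₂
  have hM₁ : I.IsMatching (before pos l M₁) :=
    ⟨fun e he => h.left_mem.1.subset he.1,
      fun a x y hx hy => h.left_mem.1.agent_unique a x y hx.1 hy.1,
      fun a b x hx hy => h.left_mem.1.object_unique a b x hx.1 hy.1⟩
  have hM₂ : I.IsMatching (before pos l M₂) :=
    ⟨fun e he => h.right_mem.1.subset he.1,
      fun a x y hx hy => h.right_mem.1.agent_unique a x y hx.1 hy.1,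
      fun a b x hx hy => h.right_mem.1.object_unique a b x hx.1 hy.1⟩
  -- An agent that gets the same object in `N` and `M` cannot prefer `N` to `M`.
  have hWK : ∀ (M : Set (A × O)), (M = M₁ ∨ M = M₂) →
      Disjoint W (matchedAgents (before pos l (M ∩ N))) := by
    intro M hM
    rw [Set.disjoint_left]
    rintro a ha ⟨x, ⟨hxM, hxN⟩, -⟩
    obtain ⟨y, hy, hp⟩ := ha M (by simpa using hM)
    obtain rfl := hN.1.agent_unique _ _ _ hxN hy
    exact hI.irrefl a x (hN.1.subset hxN) (hp x hxM)
  have hKK : Disjoint K₁ K₂ := by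
    rw [Set.disjoint_left]
    rintro a ⟨x, ⟨hx, -⟩, -⟩ ⟨y, ⟨hy, -⟩, -⟩
    exact h.disjoint a x y hx hy
  have hAA : Disjoint (matchedAgents (before pos l M₁)) (matchedAgents (before pos l M₂)) := by
    rw [Set.disjoint_left]
    rintro a ⟨x, hx, -⟩ ⟨y, hy, -⟩
    exact h.disjoint a x y hx hy
  -- `K₂` may be counted against `M₁` because each entry of `M₂` was spanned by `M₁` when it was
  -- made.
  have c1 : (W ∪ K₁ ∪ K₂).ncard ≤ (matchedAgents (before pos l M₁)).ncard := by
    refine ncard_le_of_subset_spanned hM₁ hN ?_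
    rintro a ((ha | ⟨x, hx, hl⟩) | ⟨x, hx, hl⟩)
    · obtain ⟨x, hx, h1, -⟩ := hW a ha
      exact ⟨x, hx, h1⟩
    · exact ⟨x, hx.2, I.mem_spanned (a := a) ⟨hx.1, hl⟩⟩
    · exact ⟨x, hx.2, I.spanned_mono (before_mono pos (le_of_lt hl) _) (h.right_spanned a x hx.1)⟩
  have c2 : (W ∪ K₂).ncard ≤ (matchedAgents (before pos l M₂)).ncard := by
    refine ncard_le_of_subset_spanned hM₂ hN ?_
    rintro a (ha | ⟨x, hx, hl⟩)
    · obtain ⟨x, hx, -, h1⟩ := hW a ha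
      exact ⟨x, hx, h1⟩
    · exact ⟨x, hx.2, I.mem_spanned (a := a) ⟨hx.1, hl⟩⟩
  have c3 : (matchedAgents (before pos l M₁) ∪ matchedAgents (before pos l M₂)).ncard ≤
      (K₁ ∪ K₂ ∪ F ∪ (W ∩ {a | pos a < l})).ncard := by
    refine Set.ncard_le_ncard ?_ (Set.toFinite _)
    -- An agent matched in just one of the two alternatives compares `N` with that one only, since
    -- any object beats being unmatched in the other. If its object differs from the one in `N`,
    -- strictness puts it in `F` or in `W`.
    have key : ∀ a x M M', (M = M₁ ∧ M' = M₂ ∨ M = M₂ ∧ M' = M₁) → (a, x) ∈ M → (a, x) ∉ N →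
        (∀ y, (a, y) ∉ M') → I.IsMatching M → a ∈ F ∪ W := by
      intro a x M M' hM hx hxN hM' hMm
      by_cases hy : ∃ y, (a, y) ∈ N ∧ I.pref a y x
      · obtain ⟨y, hy, hyx⟩ := hy
        have h1 : I.Prefers a N M :=
          ⟨y, hy, fun z hz => hMm.agent_unique _ _ _ hx hz ▸ hyx⟩
        have h2 : I.Prefers a N M' := ⟨y, hy, fun z hz => absurd hz (hM' z)⟩
        refine Or.inr ?_
        rintro Y (rfl | rfl) <;> rcases hM with ⟨rfl, rfl⟩ | ⟨rfl, rfl⟩ <;> assumption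
      · refine Or.inl ⟨M, ?_, x, hx, fun y hyN => ?_⟩
        · rcases hM with ⟨rfl, rfl⟩ | ⟨rfl, rfl⟩ <;> simp
        · rcases hI.total a x y (hMm.subset hx) (hN.1.subset hyN)
            (by rintro rfl; exact hxN hyN) with h1 | h1
          exacts [h1, absurd ⟨y, hyN, h1⟩ hy]
    rintro a (⟨x, hx, hl⟩ | ⟨x, hx, hl⟩)
    · by_cases hxN : (a, x) ∈ N
      · exact Or.inl (Or.inl (Or.inl ⟨x, ⟨hx, hxN⟩, hl⟩))
      · rcases key a x M₁ M₂ (Or.inl ⟨rfl, rfl⟩) hx hxN (fun y => h.disjoint a x y hx)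
          h.left_mem.1 with h1 | h1
        exacts [Or.inl (Or.inr h1), Or.inr ⟨h1, hl⟩]
    · by_cases hxN : (a, x) ∈ N
      · exact Or.inl (Or.inl (Or.inr ⟨x, ⟨hx, hxN⟩, hl⟩))
      · rcases key a x M₂ M₁ (Or.inr ⟨rfl, rfl⟩) hx hxN (fun y hy => h.disjoint a y x hy hx)
          h.right_mem.1 with h1 | h1
        exacts [Or.inl (Or.inr h1), Or.inr ⟨h1, hl⟩]
  have hWK₁ : Disjoint W K₁ := hWK M₁ (Or.inl rfl)
  have hWK₂ : Disjoint W K₂ := hWK M₂ (Or.inr rfl)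
  rw [Set.ncard_union_eq hAA] at c3
  rw [Set.ncard_union_eq (Set.disjoint_union_left.2 ⟨hWK₂, hKK⟩),
    Set.ncard_union_eq hWK₁] at c1
  rw [Set.ncard_union_eq hWK₂] at c2
  have d1 := Set.ncard_union_le (K₁ ∪ K₂ ∪ F) (W ∩ {a | pos a < l})
  have d2 := Set.ncard_union_le (K₁ ∪ K₂) F
  have d3 := Set.ncard_union_le K₁ K₂
  omega

theorem margin_pos (h : I.IsGreedy pos k M₁ M₂) (hI : I.StrictRankings) (hk : ∀ a, pos a < k)
    (h₂ : M₂.Nonempty) {N : Set (A × O)} (hN : N ∈ I.alternatives) :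
    0 < I.margin {M₁, M₂} N := by
  have hsp : ∀ a, (∀ Y ∈ ({M₁, M₂} : Set _), I.Prefers a N Y) → ∃ x, (a, x) ∈ N ∧
      x ∈ I.spanned (before pos (pos a) M₁) ∧ x ∈ I.spanned (before pos (pos a) M₂) := by
    intro a ha
    obtain ⟨x, hx, hx₁⟩ := ha M₁ (by simp)
    obtain ⟨y, hy, hy₂⟩ := ha M₂ (by simp)
    obtain rfl := hN.1.agent_unique _ _ _ hx hy
    exact ⟨x, hx, h.spanned_of_prefers hI (hk a) (hN.1.subset hx)
      fun z hz => hz.elim (hx₁ z) (hy₂ z)⟩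
  have hlt : I.votesAgainstSet {M₁, M₂} N < I.votesForSet {M₁, M₂} N := by
    rcases ({a | ∀ Y ∈ ({M₁, M₂} : Set _), I.Prefers a N Y} : Set A).eq_empty_or_nonempty with
      hW | hW
    · obtain ⟨h1, h2⟩ := h.counting hI hN k fun a ha =>
        absurd ha (Set.eq_empty_iff_forall_notMem.1 hW a)
      have h0 : I.votesAgainstSet {M₁, M₂} N = 0 := by rw [votesAgainstSet, hW, Set.ncard_empty]
      rw [before_eq_self h.lt_right, hW, Set.empty_inter, Set.ncard_empty] at h1
      obtain ⟨⟨a, x⟩, hax⟩ := h₂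
      have : 0 < (matchedAgents M₂).ncard := (Set.ncard_pos (Set.toFinite _)).2 ⟨a, x, hax⟩
      omega
    -- Cut at the last agent `w` that votes for `N`: what all these agents want is spanned before
    -- `w`, while `w` itself falls outside the cut. The latter makes the inequality strict.
    · obtain ⟨w, hw, hmax⟩ := Set.exists_max_image _ pos (Set.toFinite _) hW
      obtain ⟨h1, h2⟩ := h.counting hI hN (pos w) fun a ha => by
        obtain ⟨x, hx, h1, h2⟩ := hsp a ha
        exact ⟨x, hx, I.spanned_mono (before_mono pos (hmax a ha) _) h1,
          I.spanned_mono (before_mono pos (hmax a ha) _) h2⟩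
      have h3 : ({a | ∀ Y ∈ ({M₁, M₂} : Set _), I.Prefers a N Y} ∩ {a | pos a < pos w}).ncard <
          I.votesAgainstSet {M₁, M₂} N :=
        Set.ncard_lt_ncard ⟨Set.inter_subset_left, fun hs => lt_irrefl (pos w) (hs hw).2⟩ (Set.toFinite _)
      omega
  rw [margin]
  omega

end IsGreedy

/-- A top-choice alternative is a Condorcet winner. -/
theorem IsTopChoice.isStronglyPopular [Finite A] {I : MatchingInstance A O} (hI : I.StrictRankings)
    {T : Set (A × O)} (hT : I.IsTopChoice T) : I.IsStronglyPopular {T} := by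
  refine ⟨Set.singleton_subset_iff.2 hT.1, fun Z hZ hne => ?_⟩
  have h0 : I.votesAgainstSet {T} Z = 0 := by
    rw [votesAgainstSet, Set.ncard_eq_zero (Set.toFinite _)]
    exact Set.eq_empty_iff_forall_notMem.2 fun a ha => hT.2 a Z hZ (ha T rfl)
  have h1 : 0 < I.votesForSet {T} Z := by
    refine (Set.ncard_pos (Set.toFinite _)).2 ?_
    -- If no agent preferred `T` to `Z` either, all agents would be indifferent, and strictness
    -- would give `T = Z`.
    simp only [Set.mem_singleton_iff, exists_eq_left]
    by_contra hemp
    have hno : ∀ a, ¬ I.Prefers a T Z := fun a ha => hemp ⟨a, ha⟩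
    refine hne (Set.singleton_eq_singleton_iff.2 (Set.Subset.antisymm ?_ ?_))
    all_goals rintro ⟨a, x⟩ hx
    · by_contra hxZ
      refine hno a ⟨x, hx, fun y hy => ?_⟩
      have hxe := hT.1.1.subset hx
      have hye := hZ.1.subset hy
      refine (hI.total a x y hxe hye (by rintro rfl; exact hxZ hy)).resolve_right fun hyx => ?_
      exact hT.2 a Z hZ ⟨y, hy, fun z hz => hT.1.1.agent_unique _ _ _ hx hz ▸ hyx⟩
    · by_contra hxT
      refine hT.2 a Z hZ ⟨x, hx, fun y hy => ?_⟩
      have hxe := hZ.1.subset hx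
      have hye := hT.1.1.subset hy
      refine (hI.total a x y hxe hye (by rintro rfl; exact hxT hy)).resolve_right fun hyx => ?_
      exact hno a ⟨y, hy, fun z hz => hZ.1.agent_unique _ _ _ hx hz ▸ hyx⟩
  rw [margin]
  omega

theorem IsGreedy.isStronglyPopular [Finite A] [Finite O] {I : MatchingInstance A O} {pos : A → ℕ}
    {k : ℕ} {M₁ M₂ : Set (A × O)} (h : I.IsGreedy pos k M₁ M₂) (hI : I.StrictRankings)
    (hk : ∀ a, pos a < k) (h₂ : M₂.Nonempty) : I.IsStronglyPopular {M₁, M₂} :=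
  ⟨by rintro Y (rfl | rfl); exacts [h.left_mem, h.right_mem],
    fun _ hN _ => h.margin_pos hI hk h₂ hN⟩

theorem exists_isStronglyPopular [Finite A] [Finite O] {I : MatchingInstance A O}
    (hI : I.StrictRankings) : ∃ S : Set (Set (A × O)), S.encard ≤ 2 ∧ I.IsStronglyPopular S := by
  let e := Finite.equivFin A
  have hpos : (fun a => (e a : ℕ)).Injective := Fin.val_injective.comp e.injective
  obtain ⟨M₁, M₂, h⟩ := exists_isGreedy hI hpos (Nat.card A)
    fun i hi => ⟨e.symm ⟨i, hi⟩, by simp⟩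
  rcases M₂.eq_empty_or_nonempty with h₂ | h₂
  · exact ⟨{M₁}, by simp,
      (h.isTopChoice_of_right_eq_empty hI (fun a => (e a).2) h₂).isStronglyPopular hI⟩
  · exact ⟨{M₁, M₂}, (Set.encard_insert_le _ _).trans (by rw [Set.encard_singleton]; norm_num), h.isStronglyPopular hI (fun a => (e a).2) h₂⟩

end MatchingInstance
-- Reasoning about programs and their running time
namespace OracleRAM

theorem Memory.write_apply (s : Memory) (k i v k' i' : ℕ) :
    s.write k i v k' i' = if k' = k ∧ i' = i then v else s k' i' := rfl

theorem Memory.write_array_of_ne (s : Memory) {k k' : ℕ} (i v : ℕ) (h : k' ≠ k) :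
    s.write k i v k' = s k' := by
  funext j; simp [Memory.write, h]

/-- Programs without loops. -/
def Program.LoopFree : Program → Prop
  | .skip => True
  | .store _ _ _ => True
  | .query _ _ => True
  | .seq p q => p.LoopFree ∧ q.LoopFree
  | .cond _ p q => p.LoopFree ∧ q.LoopFree
  | .loop _ _ => False

open Classical in
/-- The effect of a program without loops. -/
noncomputable def Program.denote (Ω : Set ℕ → Prop) : Program → Memory → Memory
  | .skip, s => s
  | .store k e f, s => s.write k (e.eval s) (f.eval s)
  | .query k r, s => s.write r 0 (if Ω {i | s k i ≠ 0} then 1 else 0)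
  | .seq p q, s => q.denote Ω (p.denote Ω s)
  | .cond b p q, s => if b.eval s ≠ 0 then p.denote Ω s else q.denote Ω s
  | .loop _ _, s => s

/-- A bound for the time taken by a program without loops. -/
def Program.maxCost : Program → ℕ
  | .skip => 1
  | .store _ e f => e.cost + f.cost + 1
  | .query _ _ => 1
  | .seq p q => p.maxCost + q.maxCost
  | .cond b p q => b.cost + (p.maxCost + q.maxCost) + 1
  | .loop _ _ => 0

/-- Started on `s`, the program `p` halts within `T` steps with a memory satisfying `Q`. -/
def Halts (Ω : Set ℕ → Prop) (p : Program) (s : Memory) (T : ℕ) (Q : Memory → Prop) : Prop :=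
  ∃ t s', Run Ω p s t s' ∧ t ≤ T ∧ Q s'

theorem Halts.mono {Ω : Set ℕ → Prop} {p : Program} {s : Memory} {T T' : ℕ} {Q Q' : Memory → Prop}
    (h : Halts Ω p s T Q) (hT : T ≤ T') (hQ : ∀ s', Q s' → Q' s') : Halts Ω p s T' Q' := by
  obtain ⟨t, s', hr, ht, hq⟩ := h
  exact ⟨t, s', hr, ht.trans hT, hQ s' hq⟩

/-- Turns the verification of a loop body into the computation of a function on memories; only the
loops then need invariants. -/
theorem halts_of_loopFree (Ω : Set ℕ → Prop) {p : Program} (hp : p.LoopFree) (s : Memory) :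
    Halts Ω p s p.maxCost (· = p.denote Ω s) := by
  induction p generalizing s with
  | skip => exact ⟨_, _, .skip s, le_rfl, rfl⟩
  | store k e f => exact ⟨_, _, .store k e f s, le_rfl, rfl⟩
  | query k r =>
    by_cases h : Ω {i | s k i ≠ 0}
    · exact ⟨_, _, .query_yes k r s h, le_rfl, by simp only [Program.denote, if_pos h]⟩
    · exact ⟨_, _, .query_no k r s h, le_rfl, by simp only [Program.denote, if_neg h]⟩
  | seq p q ihp ihq =>
    obtain ⟨t, s', hr, ht, rfl⟩ := ihp hp.1 s
    obtain ⟨t', s'', hr', ht', rfl⟩ := ihq hp.2 _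
    exact ⟨_, _, .seq hr hr', Nat.add_le_add ht ht', rfl⟩
  | cond b p q ihp ihq =>
    by_cases hb : b.eval s = 0
    · obtain ⟨t, s', hr, ht, rfl⟩ := ihq hp.2 s
      refine ⟨_, _, .cond_false p hb hr, ?_, by simp [Program.denote, hb]⟩
      simp only [Program.maxCost]; omega
    · obtain ⟨t, s', hr, ht, rfl⟩ := ihp hp.1 s
      refine ⟨_, _, .cond_true q hb hr, ?_, by simp [Program.denote, hb]⟩
      simp only [Program.maxCost]; omega
  | loop b p => exact hp.elim

theorem Halts.seq {Ω : Set ℕ → Prop} {p q : Program} {s : Memory} {T T' : ℕ}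
    {Q R : Memory → Prop} (hp : Halts Ω p s T Q) (hq : ∀ s', Q s' → Halts Ω q s' T' R) :
    Halts Ω (.seq p q) s (T + T') R := by
  obtain ⟨t, s', hr, ht, hQ⟩ := hp
  obtain ⟨t', s'', hr', ht', hR⟩ := hq s' hQ
  exact ⟨_, _, .seq hr hr', Nat.add_le_add ht ht', hR⟩

theorem Halts.cond {Ω : Set ℕ → Prop} {b : Expr} {p q : Program} {s : Memory} {T T' : ℕ}
    {R : Memory → Prop} (hp : b.eval s ≠ 0 → Halts Ω p s T R) (hq : b.eval s = 0 → Halts Ω q s T' R) :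
    Halts Ω (.cond b p q) s (b.cost + (T + T') + 1) R := by
  by_cases hb : b.eval s = 0
  · obtain ⟨t, s', hr, ht, hR⟩ := hq hb
    exact ⟨_, _, .cond_false p hb hr, by omega, hR⟩
  · obtain ⟨t, s', hr, ht, hR⟩ := hp hb
    exact ⟨_, _, .cond_true q hb hr, by omega, hR⟩

/-- A loop with a counter that ends after exactly `N` rounds. -/
theorem halts_loop {Ω : Set ℕ → Prop} {b : Expr} {p : Program} (Inv : ℕ → Memory → Prop) (N c : ℕ)
    (hb : ∀ i s, i ≤ N → Inv i s → (b.eval s ≠ 0 ↔ i < N))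
    (hp : ∀ i s, i < N → Inv i s → Halts Ω p s c (Inv (i + 1))) {s : Memory} (hs : Inv 0 s) :
    Halts Ω (.loop b p) s (N * (b.cost + c + 1) + b.cost + 1) (Inv N) := by
  -- Induct on the number `d` of rounds still to go, with the starting memory arbitrary.
  suffices H : ∀ d i s, i + d = N → Inv i s →
      Halts Ω (.loop b p) s (d * (b.cost + c + 1) + b.cost + 1) (Inv N) from H N 0 s (by omega) hs
  intro d
  induction d with
  | zero =>
    intro i s hi h
    obtain rfl : i = N := by omega
    have : b.eval s = 0 := by
      by_contra hn
      exact lt_irrefl _ ((hb i s le_rfl h).1 hn)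
    exact ⟨_, _, .loop_false p this, by omega, h⟩
  | succ d ih =>
    intro i s hi h
    obtain ⟨t, s', hr, ht, h'⟩ := hp i s (by omega) h
    obtain ⟨t', s'', hr', ht', h''⟩ := ih (i + 1) s' (by omega) h'
    refine ⟨_, _, .loop_true ((hb i s (by omega) h).2 (by omega)) hr hr', ?_, h''⟩
    rw [Nat.succ_mul]
    omega

/-! ### The greedy program -/

/-- The scalar variable stored in cell `0` of array `k`. -/
def Expr.var (k : ℕ) : Expr := .cell k (.const 0)

/-- Assignment to a scalar variable. -/
def Program.assign (k : ℕ) (e : Expr) : Program := .store k (.const 0) e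

@[simp] theorem Expr.eval_var (k : ℕ) (s : Memory) : (Expr.var k).eval s = s k 0 := rfl

/-! The programs of the greedy algorithm use array `0` for the numbers of agents and objects, `1` and
`2` for the tables, `3` and `4` for the two matchings, `5` for the report, `6` and `7` for the sets of
matched objects, and the scalar variables `8` (agent), `9` (start of the agent's row in table `1`),
`10` (object), `11` (start of the row in table `2`), `12` (successor of the best object found, or `0`),
`13` (the matching that it extends), `14` (answer of the oracle), `15` (whether the second matching
is nonempty). -/

/-- Test whether the current object extends the set of objects in array `k`. -/
def testObject (k : ℕ) : Program :=
  .cond (.eq (.cell k (.var 10)) (.const 0))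
    (.seq (.store k (.var 10) (.const 1)) (.seq (.query k 14) (.store k (.var 10) (.const 0))))
    (.assign 14 (.const 0))

/-- Make the current object the best one found if it extends one of the matchings. -/
def tryObject : Program :=
  .seq (testObject 6) (.cond (.var 14)
    (.seq (.assign 12 (.add (.var 10) (.const 1))) (.assign 13 (.const 1)))
    (.seq (testObject 7) (.cond (.var 14)
      (.seq (.assign 12 (.add (.var 10) (.const 1))) (.assign 13 (.const 2)))
      .skip)))

/-- Consider the current object for the current agent. -/
def considerObject : Program :=
  .cond (.cell 1 (.add (.var 9) (.var 10)))
    (.cond (.var 12)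
      (.cond (.cell 2 (.add (.var 11) (.sub (.var 12) (.const 1)))) tryObject .skip)
      tryObject)
    .skip

/-- Consider the current object for the current agent and move on to the next object. -/
def scanObject : Program :=
  .seq considerObject (.seq (.assign 11 (.add (.var 11) (.cell 0 (.const 1))))
    (.assign 10 (.add (.var 10) (.const 1))))

/-- Match the current agent to the best object found and move on to the next agent. -/
def matchAgent : Program :=
  .seq (.cond (.var 12)
      (.cond (.eq (.var 13) (.const 1))
        (.seq (.store 3 (.var 8) (.var 12)) (.store 6 (.sub (.var 12) (.const 1)) (.const 1)))
        (.seq (.store 4 (.var 8) (.var 12))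
          (.seq (.store 7 (.sub (.var 12) (.const 1)) (.const 1)) (.assign 15 (.const 1)))))
      .skip)
    (.seq (.assign 9 (.add (.var 9) (.cell 0 (.const 1)))) (.assign 8 (.add (.var 8) (.const 1))))

/-- Start the search for the best object. -/
def resetScan : Program := .seq (.assign 10 (.const 0)) (.assign 12 (.const 0))

/-- Serve the current agent. -/
def serveAgent : Program :=
  .seq resetScan (.seq (.loop (.lt (.var 10) (.cell 0 (.const 1))) scanObject) matchAgent)

/-- Copy the entry of the current agent from the first to the second matching. -/
def copyEntry : Program :=
  .seq (.store 4 (.var 8) (.cell 3 (.var 8))) (.assign 8 (.add (.var 8) (.const 1)))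

/-- The condition that there is another agent. -/
def moreAgents : Expr := .lt (.var 8) (.var 0)

/-- The greedy algorithm. -/
def greedyProgram : Program :=
  .seq (.loop moreAgents serveAgent)
    (.cond (.var 15) .skip
      (.seq (.assign 8 (.const 0)) (.seq (.loop moreAgents copyEntry) (.assign 5 (.const 1)))))

open Classical in
-- The object is marked only for the duration of the query, so array `k` is restored and just the
-- answer remains. Objects already marked are rejected without a query, since the oracle would
-- accept them. The array must not be one of the scalars used by the test.
theorem denote_testObject (Ω : Set ℕ → Prop) {k : ℕ} (h10 : k ≠ 10) (h14 : k ≠ 14) (s : Memory) :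
    (testObject k).denote Ω s = s.write 14 0
      (if s k (s 10 0) = 0 ∧ Ω {i | i = s 10 0 ∨ s k i ≠ 0} then 1 else 0) := by
  by_cases h : s k (s 10 0) = 0
  · have hset : {i | s.write k (s 10 0) 1 k i ≠ 0} = {i | i = s 10 0 ∨ s k i ≠ 0} := by
      ext i
      by_cases hi : i = s 10 0 <;> simp [Memory.write, hi]
    simp only [testObject, Program.denote, Expr.eval, Expr.eval_var, h, hset]
    funext k' i'
    by_cases hk : k' = k
    · subst hk
      by_cases hi : i' = s 10 0
      · subst hi; simp [Memory.write_apply, h14, h, h10.symm]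
      · simp [Memory.write_apply, hi, h14, h10.symm]
    · simp [Memory.write_apply, hk, h10.symm]
  · simp [testObject, Program.denote, Expr.eval, h, Program.assign]

/-- The effect of `tryObject`. -/
theorem denote_tryObject (Ω : Set ℕ → Prop) (s : Memory) :
    (∀ k, k ∉ ({12, 13, 14} : Set ℕ) → tryObject.denote Ω s k = s k) ∧
    (((s 6 (s 10 0) = 0 ∧ Ω {i | i = s 10 0 ∨ s 6 i ≠ 0}) ∧
        tryObject.denote Ω s 12 0 = s 10 0 + 1 ∧ tryObject.denote Ω s 13 0 = 1) ∨
      (¬ (s 6 (s 10 0) = 0 ∧ Ω {i | i = s 10 0 ∨ s 6 i ≠ 0}) ∧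
        (s 7 (s 10 0) = 0 ∧ Ω {i | i = s 10 0 ∨ s 7 i ≠ 0}) ∧
        tryObject.denote Ω s 12 0 = s 10 0 + 1 ∧ tryObject.denote Ω s 13 0 = 2) ∨
      (¬ (s 6 (s 10 0) = 0 ∧ Ω {i | i = s 10 0 ∨ s 6 i ≠ 0}) ∧
        ¬ (s 7 (s 10 0) = 0 ∧ Ω {i | i = s 10 0 ∨ s 7 i ≠ 0}) ∧
        tryObject.denote Ω s 12 0 = s 12 0 ∧ tryObject.denote Ω s 13 0 = s 13 0)) := by
  by_cases h6 : s 6 (s 10 0) = 0 ∧ Ω {i | i = s 10 0 ∨ s 6 i ≠ 0}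
  · have hd : tryObject.denote Ω s =
        ((s.write 14 0 1).write 12 0 (s 10 0 + 1)).write 13 0 1 := by
      rw [tryObject, Program.denote, denote_testObject Ω (by norm_num) (by norm_num), if_pos h6]
      simp [Program.denote, Program.assign, Expr.eval, Memory.write_apply]
    rw [hd]
    refine ⟨fun k hk => ?_, Or.inl ⟨h6, ?_, ?_⟩⟩
    · simp only [Set.mem_insert_iff, Set.mem_singleton_iff, not_or] at hk
      rw [Memory.write_array_of_ne _ _ _ hk.2.1, Memory.write_array_of_ne _ _ _ hk.1,
        Memory.write_array_of_ne _ _ _ hk.2.2]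
    all_goals simp [Memory.write_apply]
  · by_cases h7 : s 7 (s 10 0) = 0 ∧ Ω {i | i = s 10 0 ∨ s 7 i ≠ 0}
    · have hd : tryObject.denote Ω s =
          (((s.write 14 0 0).write 14 0 1).write 12 0 (s 10 0 + 1)).write 13 0 2 := by
        rw [tryObject, Program.denote, denote_testObject Ω (by norm_num) (by norm_num), if_neg h6,
          Program.denote, if_neg (by simp [Memory.write_apply]), Program.denote,
          denote_testObject Ω (by norm_num) (by norm_num), if_pos]
        · simp [Program.denote, Program.assign, Expr.eval, Memory.write_apply]
        · simpa [Memory.write_apply] using h7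
      rw [hd]
      refine ⟨fun k hk => ?_, Or.inr (Or.inl ⟨h6, h7, ?_, ?_⟩)⟩
      · simp only [Set.mem_insert_iff, Set.mem_singleton_iff, not_or] at hk
        rw [Memory.write_array_of_ne _ _ _ hk.2.1, Memory.write_array_of_ne _ _ _ hk.1,
          Memory.write_array_of_ne _ _ _ hk.2.2, Memory.write_array_of_ne _ _ _ hk.2.2]
      all_goals simp [Memory.write_apply]
    · have hd : tryObject.denote Ω s = (s.write 14 0 0).write 14 0 0 := by
        rw [tryObject, Program.denote, denote_testObject Ω (by norm_num) (by norm_num), if_neg h6,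
          Program.denote, if_neg (by simp [Memory.write_apply]), Program.denote,
          denote_testObject Ω (by norm_num) (by norm_num), if_neg]
        · simp [Program.denote, Memory.write_apply]
        · simpa [Memory.write_apply] using h7
      rw [hd]
      refine ⟨fun k hk => ?_, Or.inr (Or.inr ⟨h6, h7, ?_, ?_⟩)⟩
      · simp only [Set.mem_insert_iff, Set.mem_singleton_iff, not_or] at hk
        rw [Memory.write_array_of_ne _ _ _ hk.2.2, Memory.write_array_of_ne _ _ _ hk.2.2]
      all_goals simp [Memory.write_apply]

end OracleRAM
-- Memory contents as matchings, marks and tables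
namespace MatchingInstance

open OracleRAM

variable {n m : ℕ}

/-- Uniqueness of division with remainder by `m`: a table index determines its row and column. -/
theorem mul_add_inj {a b x y : ℕ} (hx : x < m) (hy : y < m) (h : a * m + x = b * m + y) :
    a = b ∧ x = y := by
  have h2 := congrArg (· % m) h
  simp only [Nat.mul_add_mod_of_lt hx, Nat.mul_add_mod_of_lt hy] at h2
  subst h2
  exact ⟨Nat.eq_of_mul_eq_mul_right (by omega) (Nat.add_right_cancel h), rfl⟩

theorem input_edges (I : MatchingInstance (Fin n) (Fin m)) (a : Fin n) (x : Fin m) :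
    I.input 1 (a * m + x) ≠ 0 ↔ (a, x) ∈ I.edges := by
  simp only [input, ne_eq, ite_eq_right_iff, one_ne_zero, imp_false, not_not]
  constructor
  · rintro ⟨b, y, h, hby⟩
    obtain ⟨h1, h2⟩ := mul_add_inj x.2 y.2 h
    rwa [Fin.ext h1, Fin.ext h2]
  · exact fun h => ⟨a, x, rfl, h⟩

theorem input_pref (I : MatchingInstance (Fin n) (Fin m)) {a : Fin n} {x y : Fin m}
    (hx : (a, x) ∈ I.edges) (hy : (a, y) ∈ I.edges) :
    I.input 2 ((a * m + x) * m + y) ≠ 0 ↔ I.pref a x y := by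
  simp only [input, ne_eq, ite_eq_right_iff, one_ne_zero, imp_false, not_not]
  constructor
  · rintro ⟨b, u, v, h, -, -, hbuv⟩
    obtain ⟨h1, h2⟩ := mul_add_inj y.2 v.2 h
    obtain ⟨h3, h4⟩ := mul_add_inj x.2 u.2 h1
    rwa [Fin.ext h2, Fin.ext h3, Fin.ext h4]
  · exact fun h => ⟨a, x, y, rfl, hx, hy, h⟩

theorem Represents.congr {s s' : Memory} {k k' : ℕ} {M : Set (Fin n × Fin m)}
    (h : Represents s k M) (hs : ∀ a : Fin n, s' k' a = s k a) : Represents s' k' M := by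
  intro a
  rw [hs]
  exact h a

theorem Represents.insert {s s' : Memory} {k : ℕ} {M : Set (Fin n × Fin m)}
    (h : Represents s k M) {a : Fin n} {x : Fin m} (ha : ∀ y, (a, y) ∉ M) (hx : s' k a = x + 1)
    (hs : ∀ b : Fin n, b ≠ a → s' k b = s k b) : Represents s' k (Insert.insert (a, x) M) := by
  intro b
  by_cases hb : b = a
  · subst hb
    simp only [Set.mem_insert_iff, Prod.mk.injEq, true_and, ha, or_false, hx]
    refine ⟨fun y => ⟨fun hy => by rw [hy], fun hy => Fin.ext (by omega)⟩, ?_⟩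
    exact ⟨fun hn => absurd rfl (hn x), fun hn => absurd hn (Nat.succ_ne_zero _)⟩
  · simp only [Set.mem_insert_iff, Prod.mk.injEq, hb, false_and, false_or, hs b hb]
    exact h b

/-- Array `k` of `s` is nonzero exactly at the objects matched by `M`. -/
def Marks (s : Memory) (k : ℕ) (M : Set (Fin n × Fin m)) : Prop :=
  ∀ i, s k i ≠ 0 ↔ ∃ x ∈ matchedObjects M, (x : ℕ) = i

theorem Marks.insert {s s' : Memory} {k : ℕ} {M : Set (Fin n × Fin m)} (h : Marks s k M)
    (a : Fin n) {x : Fin m} (hx : s' k x ≠ 0) (hs : ∀ i, i ≠ (x : ℕ) → s' k i = s k i) :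
    Marks s' k (Insert.insert (a, x) M) := by
  intro i
  rw [matchedObjects_insert]
  by_cases hi : i = (x : ℕ)
  · subst hi
    exact ⟨fun _ => ⟨x, Or.inl rfl, rfl⟩, fun _ => hx⟩
  · rw [hs i hi, h i]
    constructor
    · rintro ⟨y, hy, rfl⟩
      exact ⟨y, Or.inr hy, rfl⟩
    · rintro ⟨y, rfl | hy, rfl⟩
      exacts [absurd rfl hi, ⟨y, hy, rfl⟩]

/-- The test by the oracle whether an object extends an alternative. -/
theorem Marks.test_iff {I : MatchingInstance (Fin n) (Fin m)} {s : Memory} {k : ℕ}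
    {M : Set (Fin n × Fin m)} (h : Marks s k M) (hM : M ∈ I.alternatives) (x : Fin m) :
    (s k x = 0 ∧ I.oracle {i | i = (x : ℕ) ∨ s k i ≠ 0}) ↔ x ∉ I.spanned M := by
  have h1 : s k x = 0 ↔ x ∉ matchedObjects M := by
    rw [← not_iff_not, not_not, ← ne_eq, h x]
    exact ⟨fun ⟨y, hy, hyx⟩ => Fin.ext hyx ▸ hy, fun hx => ⟨x, hx, rfl⟩⟩
  have h2 : {y : Fin m | (y : ℕ) ∈ {i | i = (x : ℕ) ∨ s k i ≠ 0}} =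
      Insert.insert x (matchedObjects M) := by
    ext y
    simp only [Set.mem_ofPred_eq, Set.mem_insert_iff, h y, Fin.val_inj]
    simp
  rw [I.notMem_spanned_iff hM, oracle, h2, h1, and_comm]

/-- `b` is the successor of the best object below `j` for `a` that extends one of the alternatives
and `c` is the number of the alternative to be extended; `b` is `0` if there is no such object. -/
def IsBestBelow (I : MatchingInstance (Fin n) (Fin m)) (a : Fin n) (M₁ M₂ : Set (Fin n × Fin m))
    (j b c : ℕ) : Prop :=
  (b = 0 ∧ ∀ y : Fin m, (y : ℕ) < j → (a, y) ∈ I.edges → y ∈ I.spanned M₁ ∧ y ∈ I.spanned M₂) ∨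
  ∃ x : Fin m, b = x + 1 ∧ (a, x) ∈ I.edges ∧
    ((c = 1 ∧ x ∉ I.spanned M₁) ∨ (c = 2 ∧ x ∈ I.spanned M₁ ∧ x ∉ I.spanned M₂)) ∧
    ∀ y : Fin m, (y : ℕ) < j → (a, y) ∈ I.edges → (y ∉ I.spanned M₁ ∨ y ∉ I.spanned M₂) →
      x = y ∨ I.pref a x y

namespace IsBestBelow

variable {I : MatchingInstance (Fin n) (Fin m)} {a : Fin n} {M₁ M₂ : Set (Fin n × Fin m)}
  {b c : ℕ} {z : Fin m}

/-- The hypothesis `hz` covers every reason to keep the current best: `z` is not adjacent, `z`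
extends neither alternative, or the current best is at least as good. -/
theorem step_same (h : IsBestBelow I a M₁ M₂ z b c)
    (hz : (a, z) ∈ I.edges → (z ∉ I.spanned M₁ ∨ z ∉ I.spanned M₂) →
      ∃ x : Fin m, b = x + 1 ∧ (x = z ∨ I.pref a x z)) :
    IsBestBelow I a M₁ M₂ (z + 1) b c := by
  have hlt : ∀ y : Fin m, (y : ℕ) < z + 1 → (y : ℕ) < z ∨ y = z := fun y hy => by
    rcases Nat.lt_succ_iff_lt_or_eq.1 hy with h1 | h1
    exacts [Or.inl h1, Or.inr (Fin.ext h1)]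
  rcases h with ⟨hb, h⟩ | ⟨x, hb, hx, hc, h⟩
  · refine Or.inl ⟨hb, fun y hy hay => ?_⟩
    rcases hlt y hy with hy | rfl
    · exact h y hy hay
    · by_contra hn
      obtain ⟨x, hx, -⟩ := hz hay (by tauto)
      omega
  · refine Or.inr ⟨x, hb, hx, hc, fun y hy hay hn => ?_⟩
    rcases hlt y hy with hy | rfl
    · exact h y hy hay hn
    · obtain ⟨x', hx', hp⟩ := hz hay hn
      obtain rfl : x = x' := Fin.ext (by omega)
      exact hp

/-- It suffices that `z` beats the old best: transitivity passes this on to all earlier admissible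
objects. -/
theorem step_new (h : IsBestBelow I a M₁ M₂ z b c) (hI : I.StrictRankings) (haz : (a, z) ∈ I.edges)
    (hz : ∀ x : Fin m, b = x + 1 → (a, x) ∈ I.edges → I.pref a z x) {c' : ℕ}
    (hc : (c' = 1 ∧ z ∉ I.spanned M₁) ∨ (c' = 2 ∧ z ∈ I.spanned M₁ ∧ z ∉ I.spanned M₂)) :
    IsBestBelow I a M₁ M₂ (z + 1) (z + 1) c' := by
  refine Or.inr ⟨z, rfl, haz, hc, fun y hy hay hn => ?_⟩
  rcases Nat.lt_succ_iff_lt_or_eq.1 hy with hy | hy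
  · rcases h with ⟨-, h⟩ | ⟨x, hb, hx, -, h⟩
    · have := h y hy hay
      tauto
    · rcases h y hy hay hn with rfl | hxy
      · exact Or.inr (hz x hb hx)
      · exact Or.inr (hI.trans a z x y haz hx hay (hz x hb hx) hxy)
  · exact Or.inl (Fin.ext hy.symm)

end IsBestBelow

/-! ### Loop invariants of the greedy program -/

/-- The memory of the greedy algorithm when agent `k` is to be served. -/
structure Holds (I : MatchingInstance (Fin n) (Fin m)) (k : ℕ) (M₁ M₂ : Set (Fin n × Fin m))
    (s : Memory) : Prop where
  agents : s 0 0 = n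
  objects : s 0 1 = m
  edges : s 1 = I.input 1
  pref : s 2 = I.input 2
  left : Represents s 3 M₁
  right : Represents s 4 M₂
  report : s 5 0 = 0
  marks_left : Marks s 6 M₁
  marks_right : Marks s 7 M₂
  agent : s 8 0 = k
  row : s 9 0 = k * m
  nonempty : s 15 0 ≠ 0 ↔ M₂.Nonempty

/-- Arrays `10` to `14` are scratch space of the scan, so the scan cannot disturb this invariant. -/
theorem Holds.congr {I : MatchingInstance (Fin n) (Fin m)} {k : ℕ} {M₁ M₂ : Set (Fin n × Fin m)}
    {s s' : Memory} (h : Holds I k M₁ M₂ s)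
    (hs : ∀ i, i ∉ ({10, 11, 12, 13, 14} : Set ℕ) → s' i = s i) : Holds I k M₁ M₂ s' where
  agents := by rw [hs 0 (by simp)]; exact h.agents
  objects := by rw [hs 0 (by simp)]; exact h.objects
  edges := by rw [hs 1 (by simp)]; exact h.edges
  pref := by rw [hs 2 (by simp)]; exact h.pref
  left := h.left.congr fun a => by rw [hs 3 (by simp)]
  right := h.right.congr fun a => by rw [hs 4 (by simp)]
  report := by rw [hs 5 (by simp)]; exact h.report
  marks_left := fun i => by rw [hs 6 (by simp)]; exact h.marks_left i
  marks_right := fun i => by rw [hs 7 (by simp)]; exact h.marks_right i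
  agent := by rw [hs 8 (by simp)]; exact h.agent
  row := by rw [hs 9 (by simp)]; exact h.row
  nonempty := by rw [hs 15 (by simp)]; exact h.nonempty

/-- The memory of the greedy algorithm when object `j` is to be considered for agent `a`. -/
structure Scans (I : MatchingInstance (Fin n) (Fin m)) (a : Fin n) (M₁ M₂ : Set (Fin n × Fin m))
    (j : ℕ) (s : Memory) : Prop where
  holds : Holds I a M₁ M₂ s
  object : s 10 0 = j
  row : s 11 0 = (a * m + j) * m
  best : IsBestBelow I a M₁ M₂ j (s 12 0) (s 13 0)

/-- An admissible object preferred to the best one so far is tried. -/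
theorem scans_tryObject {I : MatchingInstance (Fin n) (Fin m)} (hI : I.StrictRankings) {a : Fin n}
    {M₁ M₂ : Set (Fin n × Fin m)} (h₁ : M₁ ∈ I.alternatives) (h₂ : M₂ ∈ I.alternatives) {z : Fin m}
    {s : Memory} (h : Scans I a M₁ M₂ z s) (haz : (a, z) ∈ I.edges)
    (hz : ∀ x : Fin m, s 12 0 = x + 1 → (a, x) ∈ I.edges → I.pref a z x) :
    IsBestBelow I a M₁ M₂ (z + 1) (tryObject.denote I.oracle s 12 0)
      (tryObject.denote I.oracle s 13 0) := by
  obtain ⟨-, hd⟩ := denote_tryObject I.oracle s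
  rw [h.object, h.holds.marks_left.test_iff h₁, h.holds.marks_right.test_iff h₂] at hd
  rcases hd with ⟨t1, e1, e2⟩ | ⟨t1, t2, e1, e2⟩ | ⟨t1, t2, e1, e2⟩
  · rw [e1, e2]
    exact h.best.step_new hI haz hz (Or.inl ⟨rfl, t1⟩)
  · rw [e1, e2]
    exact h.best.step_new hI haz hz (Or.inr ⟨rfl, not_not.1 t1, t2⟩)
  · rw [e1, e2]
    exact h.best.step_same fun _ hn => by tauto

theorem scans_considerObject {I : MatchingInstance (Fin n) (Fin m)} (hI : I.StrictRankings)
    {a : Fin n} {M₁ M₂ : Set (Fin n × Fin m)} (h₁ : M₁ ∈ I.alternatives) (h₂ : M₂ ∈ I.alternatives)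
    {z : Fin m} {s : Memory} (h : Scans I a M₁ M₂ z s) :
    (∀ k, k ∉ ({12, 13, 14} : Set ℕ) → considerObject.denote I.oracle s k = s k) ∧
    IsBestBelow I a M₁ M₂ (z + 1) (considerObject.denote I.oracle s 12 0)
      (considerObject.denote I.oracle s 13 0) := by
  have hedge : s 1 (s 9 0 + s 10 0) ≠ 0 ↔ (a, z) ∈ I.edges := by
    rw [h.holds.edges, h.holds.row, h.object, input_edges]
  have hd : considerObject.denote I.oracle s = if s 1 (s 9 0 + s 10 0) ≠ 0 then
      if s 12 0 ≠ 0 then if s 2 (s 11 0 + (s 12 0 - 1)) ≠ 0 then tryObject.denote I.oracle s else s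
      else tryObject.denote I.oracle s else s := rfl
  by_cases c1 : s 1 (s 9 0 + s 10 0) ≠ 0
  · rw [if_pos c1] at hd
    have haz := hedge.1 c1
    by_cases c2 : s 12 0 ≠ 0
    · rw [if_pos c2] at hd
      obtain ⟨x, hbx, hax⟩ : ∃ x : Fin m, s 12 0 = x + 1 ∧ (a, x) ∈ I.edges := by
        rcases h.best with ⟨h0, -⟩ | ⟨x, hbx, hax, -⟩
        exacts [absurd h0 c2, ⟨x, hbx, hax⟩]
      have hp : s 2 (s 11 0 + (s 12 0 - 1)) ≠ 0 ↔ I.pref a z x := by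
        rw [h.holds.pref, h.row, hbx, Nat.add_sub_cancel, input_pref I haz hax]
      by_cases c3 : s 2 (s 11 0 + (s 12 0 - 1)) ≠ 0
      · rw [hd, if_pos c3]
        refine ⟨(denote_tryObject I.oracle s).1, scans_tryObject hI h₁ h₂ h haz fun y hy _ => ?_⟩
        obtain rfl : x = y := Fin.ext (by omega)
        exact hp.1 c3
      -- No oracle call is needed here: by totality the current best equals `z` or is preferred to
      -- it.
      · rw [hd, if_neg c3]
        refine ⟨fun _ _ => rfl, h.best.step_same fun _ _ => ⟨x, hbx, ?_⟩⟩
        by_contra hn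
        rw [not_or] at hn
        exact c3 (hp.2 ((hI.total a x z hax haz hn.1).resolve_left hn.2))
    · rw [hd, if_neg c2]
      refine ⟨(denote_tryObject I.oracle s).1, scans_tryObject hI h₁ h₂ h haz fun x hx => ?_⟩
      omega
  · rw [hd, if_neg c1]
    exact ⟨fun _ _ => rfl, h.best.step_same fun he => absurd (hedge.2 he) c1⟩

theorem scans_scanObject {I : MatchingInstance (Fin n) (Fin m)} (hI : I.StrictRankings) {a : Fin n}
    {M₁ M₂ : Set (Fin n × Fin m)} (h₁ : M₁ ∈ I.alternatives) (h₂ : M₂ ∈ I.alternatives) {j : ℕ}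
    (hj : j < m) {s : Memory} (h : Scans I a M₁ M₂ j s) :
    Scans I a M₁ M₂ (j + 1) (scanObject.denote I.oracle s) := by
  obtain ⟨z, rfl⟩ : ∃ z : Fin m, (z : ℕ) = j := ⟨⟨j, hj⟩, rfl⟩
  obtain ⟨hfix, hbest⟩ := scans_considerObject hI h₁ h₂ h
  set s' := considerObject.denote I.oracle s with hs'
  have hd : scanObject.denote I.oracle s =
      (s'.write 11 0 (s' 11 0 + s' 0 1)).write 10 0 (s' 10 0 + 1) := by
    simp [scanObject, Program.denote, Program.assign, Expr.eval, Memory.write_apply, hs']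
  rw [hd]
  refine ⟨h.holds.congr fun i hi => ?_, ?_, ?_, ?_⟩
  · simp only [Set.mem_insert_iff, Set.mem_singleton_iff, not_or] at hi
    rw [Memory.write_array_of_ne _ _ _ hi.1, Memory.write_array_of_ne _ _ _ hi.2.1, hfix]
    simp [hi]
  · simp [Memory.write_apply, hfix 10, h.object]
  · simp [Memory.write_apply, hfix 11, hfix 0, h.row, h.holds.objects]
    ring
  · simpa [Memory.write_apply] using hbest

/-- The memory at the beginning of the service of agent `k`. -/
structure Serves (I : MatchingInstance (Fin n) (Fin m)) (k : ℕ) (M₁ M₂ : Set (Fin n × Fin m))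
    (s : Memory) : Prop where
  greedy : I.IsGreedy (Fin.val : Fin n → ℕ) k M₁ M₂
  holds : Holds I k M₁ M₂ s
  row : s 11 0 = k * m * m

theorem serves_zero (I : MatchingInstance (Fin n) (Fin m)) : Serves I 0 ∅ ∅ I.input where
  greedy := I.isGreedy_zero _
  holds :=
    { agents := rfl
      objects := rfl
      edges := rfl
      pref := rfl
      left := fun a => by simp [input]
      right := fun a => by simp [input]
      report := rfl
      marks_left := fun i => by simp [input, matchedObjects]
      marks_right := fun i => by simp [input, matchedObjects]
      agent := rfl
      row := by simp [input]
      nonempty := by simp [input] }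
  row := by simp [input]

/-- The three outcomes of a completed scan are the hypotheses of `IsGreedy.step_none`,
`IsGreedy.step_left` and `IsGreedy.step_right`. -/
theorem serves_matchAgent {I : MatchingInstance (Fin n) (Fin m)} {a : Fin n}
    {M₁ M₂ : Set (Fin n × Fin m)} (hg : I.IsGreedy (Fin.val : Fin n → ℕ) a M₁ M₂) {s : Memory}
    (h : Scans I a M₁ M₂ m s) :
    ∃ M₁' M₂', Serves I (a + 1) M₁' M₂' (matchAgent.denote I.oracle s) := by
  have ha₁ : ∀ y, (a, y) ∉ M₁ := fun y hy => lt_irrefl _ (hg.lt_left _ _ hy)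
  have ha₂ : ∀ y, (a, y) ∉ M₂ := fun y hy => lt_irrefl _ (hg.lt_right _ _ hy)
  -- After `m` objects the row pointer of the preference table already stands at the next agent's
  -- block, so it is never reset and no multiplication is needed.
  have hrow : s 11 0 = (a + 1) * m * m := by rw [h.row]; ring
  have h8 := h.holds.agent
  rcases h.best with ⟨h0, hbest⟩ | ⟨x, hb, hax, hc, hbest⟩
  · have hd : matchAgent.denote I.oracle s = (s.write 9 0 (a * m + m)).write 8 0 (a + 1) := by
      simp [matchAgent, Program.denote, Program.assign, Expr.eval, Memory.write_apply, h0,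
        h.holds.row, h.holds.agent, h.holds.objects]
    rw [hd]
    refine ⟨M₁, M₂, hg.step_none Fin.val_injective rfl fun x hx => hbest x x.2 hx, ?_, ?_⟩
    · exact
        { agents := h.holds.agents
          objects := h.holds.objects
          edges := h.holds.edges
          pref := h.holds.pref
          left := h.holds.left.congr fun _ => rfl
          right := h.holds.right.congr fun _ => rfl
          report := h.holds.report
          marks_left := h.holds.marks_left
          marks_right := h.holds.marks_right
          agent := rfl
          row := (Nat.succ_mul _ _).symm
          nonempty := h.holds.nonempty }
    · exact hrow
  · rcases hc with ⟨hc, hx⟩ | ⟨hc, hx₁, hx⟩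
    · have hd : matchAgent.denote I.oracle s =
          (((s.write 3 a (x + 1)).write 6 x 1).write 9 0 (a * m + m)).write 8 0 (a + 1) := by
        simp [matchAgent, Program.denote, Program.assign, Expr.eval, Memory.write_apply, hb, hc,
          h.holds.row, h.holds.agent, h.holds.objects]
      rw [hd]
      refine ⟨_, _, hg.step_left Fin.val_injective rfl hax hx fun y => hbest y y.2, ?_, ?_⟩
      · exact
          { agents := h.holds.agents
            objects := h.holds.objects
            edges := h.holds.edges
            pref := h.holds.pref
            left := h.holds.left.insert ha₁ (by simp [Memory.write_apply])
              fun b hb => by simp [Memory.write_apply, Fin.val_inj, hb]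
            right := h.holds.right.congr fun _ => rfl
            report := h.holds.report
            marks_left := h.holds.marks_left.insert a (by simp [Memory.write_apply])
              fun i hi => by simp [Memory.write_apply, hi]
            marks_right := h.holds.marks_right
            agent := rfl
            row := (Nat.succ_mul _ _).symm
            nonempty := h.holds.nonempty }
      · exact hrow
    · have hd : matchAgent.denote I.oracle s =
          ((((s.write 4 a (x + 1)).write 7 x 1).write 15 0 1).write 9 0 (a * m + m)).write 8 0
            (a + 1) := by
        simp [matchAgent, Program.denote, Program.assign, Expr.eval, Memory.write_apply, hb, hc,
          h.holds.row, h.holds.agent, h.holds.objects]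
      rw [hd]
      refine ⟨_, _, hg.step_right Fin.val_injective rfl hax hx₁ hx fun y => hbest y y.2, ?_, ?_⟩
      · exact
          { agents := h.holds.agents
            objects := h.holds.objects
            edges := h.holds.edges
            pref := h.holds.pref
            left := h.holds.left.congr fun _ => rfl
            right := h.holds.right.insert ha₂ (by simp [Memory.write_apply])
              fun b hb => by simp [Memory.write_apply, Fin.val_inj, hb]
            report := h.holds.report
            marks_left := h.holds.marks_left
            marks_right := h.holds.marks_right.insert a (by simp [Memory.write_apply])
              fun i hi => by simp [Memory.write_apply, hi]
            agent := rfl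
            row := (Nat.succ_mul _ _).symm
            nonempty := iff_of_true Nat.one_ne_zero (Set.insert_nonempty _ _) }
      · exact hrow

/-- A bound for the time in which one of `n` agents is served if there are `m` objects. -/
def serveTime (m : ℕ) : ℕ :=
  resetScan.maxCost + (m * ((Expr.lt (.var 10) (.cell 0 (.const 1))).cost + scanObject.maxCost + 1) +
    (Expr.lt (.var 10) (.cell 0 (.const 1))).cost + 1 + matchAgent.maxCost)

theorem halts_serveAgent {I : MatchingInstance (Fin n) (Fin m)} (hI : I.StrictRankings) {k : ℕ}
    (hk : k < n) {M₁ M₂ : Set (Fin n × Fin m)} {s : Memory} (h : Serves I k M₁ M₂ s) :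
    Halts I.oracle serveAgent s (serveTime m) fun s' => ∃ M₁' M₂', Serves I (k + 1) M₁' M₂' s' := by
  obtain ⟨a, rfl⟩ : ∃ a : Fin n, (a : ℕ) = k := ⟨⟨k, hk⟩, rfl⟩
  refine (halts_of_loopFree _ (by simp [resetScan, Program.assign, Program.LoopFree]) s).seq ?_
  rintro _ rfl
  have h0 : Scans I a M₁ M₂ 0 (resetScan.denote I.oracle s) := by
    have hd : resetScan.denote I.oracle s = (s.write 10 0 0).write 12 0 0 := rfl
    rw [hd]
    refine ⟨h.holds.congr fun i hi => ?_, rfl, h.row, Or.inl ⟨rfl, fun y hy => by omega⟩⟩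
    simp only [Set.mem_insert_iff, Set.mem_singleton_iff, not_or] at hi
    rw [Memory.write_array_of_ne _ _ _ hi.2.2.1, Memory.write_array_of_ne _ _ _ hi.1]
  refine (halts_loop (Scans I a M₁ M₂) m scanObject.maxCost ?_ ?_ h0).seq ?_
  · intro i s' _ hs'
    simp [Expr.eval, hs'.object, hs'.holds.objects]
  · intro i s' hi hs'
    refine (halts_of_loopFree _ (by simp [scanObject, considerObject, tryObject, testObject,
      Program.assign, Program.LoopFree]) s').mono le_rfl ?_
    rintro _ rfl
    exact scans_scanObject hI h.greedy.left_mem h.greedy.right_mem hi hs'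
  · intro s' hs'
    refine (halts_of_loopFree _ (by simp [matchAgent, Program.assign, Program.LoopFree])
      s').mono le_rfl ?_
    rintro _ rfl
    exact serves_matchAgent h.greedy hs'

/-- The copy loop copies array `3` to array `4`. -/
theorem halts_copy (Ω : Set ℕ → Prop) {s : Memory} (h0 : s 0 0 = n) (h8 : s 8 0 = 0) :
    Halts Ω (.loop moreAgents copyEntry) s
      (n * (moreAgents.cost + copyEntry.maxCost + 1) + moreAgents.cost + 1)
      fun s' => s' 3 = s 3 ∧ ∀ i < n, s' 4 i = s 3 i := by
  have hloop := halts_loop (Ω := Ω) (b := moreAgents) (p := copyEntry)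
    (fun i s' => s' 0 0 = n ∧ s' 8 0 = i ∧ s' 3 = s 3 ∧ ∀ j < i, s' 4 j = s 3 j) n
    copyEntry.maxCost (s := s) ?_ ?_ ⟨h0, h8, rfl, fun j hj => by omega⟩
  · exact hloop.mono le_rfl fun s' hs' => ⟨hs'.2.2.1, hs'.2.2.2⟩
  · rintro i s' - ⟨h1, h2, -, -⟩
    simp [moreAgents, Expr.eval, h1, h2]
  · rintro i s' - ⟨h1, h2, h3, h4⟩
    refine (halts_of_loopFree Ω (by simp [copyEntry, Program.assign, Program.LoopFree])
      s').mono le_rfl ?_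
    rintro _ rfl
    have hd : copyEntry.denote Ω s' = (s'.write 4 i (s 3 i)).write 8 0 (i + 1) := by
      simp [copyEntry, Program.denote, Program.assign, Expr.eval, Memory.write_apply, h2, h3]
    rw [hd]
    refine ⟨h1, rfl, h3, fun j hj => ?_⟩
    rcases Nat.lt_succ_iff_lt_or_eq.1 hj with hj | rfl
    · simp [Memory.write_apply, h4 j hj, hj.ne]
    · simp [Memory.write_apply]

/-! ### Correctness and polynomial running time -/

/-- A bound for the running time of the greedy algorithm. -/
def greedyTime (n m : ℕ) : ℕ :=
  n * (moreAgents.cost + serveTime m + 1) + moreAgents.cost + 1 +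
    ((Expr.var 15).cost + (Program.skip.maxCost + ((Program.assign 8 (.const 0)).maxCost +
      (n * (moreAgents.cost + copyEntry.maxCost + 1) + moreAgents.cost + 1 +
        (Program.assign 5 (.const 1)).maxCost))) + 1)

theorem halts_greedyProgram {I : MatchingInstance (Fin n) (Fin m)} (hI : I.StrictRankings) :
    Halts I.oracle greedyProgram I.input (greedyTime n m) fun s =>
      ∃ M₁ M₂, Represents s 3 M₁ ∧ Represents s 4 M₂ ∧ I.IsStronglyPopular {M₁, M₂} ∧
        ((∃ M, I.IsTopChoice M) → M₁ = M₂ ∧ I.IsTopChoice M₁ ∧ s 5 0 = 1) ∧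
        ((¬ ∃ M, I.IsTopChoice M) → s 5 0 = 0) := by
  -- The invariant quantifies over the greedy pair, so the pair may depend on the run.
  refine (halts_loop (fun k s => ∃ M₁ M₂, Serves I k M₁ M₂ s) n (serveTime m) ?_ ?_
    ⟨∅, ∅, serves_zero I⟩).seq ?_
  · rintro i s - ⟨M₁, M₂, h⟩
    simp [moreAgents, Expr.eval, h.holds.agent, h.holds.agents]
  · rintro i s hi ⟨M₁, M₂, h⟩
    exact halts_serveAgent hI hi h
  rintro s ⟨M₁, M₂, h⟩
  have hk : ∀ a : Fin n, (a : ℕ) < n := fun a => a.2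
  refine Halts.cond (fun hb => ?_) fun hb => ?_
  · have h₂ : M₂.Nonempty := h.holds.nonempty.1 hb
    refine (halts_of_loopFree _ (p := .skip) trivial s).mono le_rfl ?_
    rintro _ rfl
    refine ⟨M₁, M₂, h.holds.left, h.holds.right, h.greedy.isStronglyPopular hI hk h₂, ?_,
      fun _ => h.holds.report⟩
    rintro ⟨T, hT⟩
    exact absurd (h.greedy.right_eq_empty_of_isTopChoice hT) h₂.ne_empty
  -- Here the first matching is copied over the empty second one, so that the output stands for a
  -- singleton.
  · have h₂ : M₂ = ∅ := by
      rw [← Set.not_nonempty_iff_eq_empty, ← h.holds.nonempty, not_not]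
      exact hb
    have htop := h.greedy.isTopChoice_of_right_eq_empty hI hk h₂
    refine (halts_of_loopFree _ (p := .assign 8 (.const 0)) trivial s).seq ?_
    rintro _ rfl
    refine (halts_copy (n := n) _ (s := (Program.assign 8 (.const 0)).denote I.oracle s) h.holds.agents rfl).seq ?_
    rintro s' ⟨h3, h4⟩
    refine (halts_of_loopFree _ (p := .assign 5 (.const 1)) trivial s').mono le_rfl ?_
    rintro _ rfl
    refine ⟨M₁, M₁, h.holds.left.congr fun a => congrFun h3 a, h.holds.left.congr fun a => h4 a a.2,
      ?_, fun _ => ⟨rfl, htop, rfl⟩, fun hn => absurd ⟨M₁, htop⟩ hn⟩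
    rw [Set.pair_eq_singleton]
    exact htop.isStronglyPopular hI

theorem exists_polynomial_greedyTime :
    ∃ T : Polynomial ℕ, ∀ n m : ℕ, greedyTime n m ≤ T.eval (n + m) := by
  -- An opaque name for the cost of the inner loop test. The polynomial below is `greedyTime` with
  -- both `n` and `m` replaced by the variable, so the bound is monotonicity.
  obtain ⟨c, hc⟩ : ∃ c, c = (Expr.lt (.var 10) (.cell 0 (.const 1))).cost := ⟨_, rfl⟩
  refine ⟨.X * (.C moreAgents.cost + (.C resetScan.maxCost + (.X * .C (c + scanObject.maxCost + 1) +
    .C (c + 1 + matchAgent.maxCost))) + 1) + .C moreAgents.cost + 1 +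
    (.C (Expr.var 15).cost + (.C Program.skip.maxCost + (.C (Program.assign 8 (.const 0)).maxCost +
      (.X * .C (moreAgents.cost + copyEntry.maxCost + 1) + .C moreAgents.cost + 1 +
        .C (Program.assign 5 (.const 1)).maxCost))) + 1), fun n m => ?_⟩
  have hn : n ≤ n + m := Nat.le_add_right n m
  have hm : m ≤ n + m := Nat.le_add_left m n
  simp only [Polynomial.eval_add, Polynomial.eval_mul, Polynomial.eval_X, Polynomial.eval_C,
    Polynomial.eval_one]
  rw [greedyTime, serveTime, ← hc]
  have h1 := Nat.mul_le_mul_right (c + scanObject.maxCost + 1) hm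
  refine Nat.add_le_add (Nat.add_le_add (Nat.add_le_add (Nat.mul_le_mul hn ?_) le_rfl) le_rfl) ?_
  · omega
  · have h2 := Nat.mul_le_mul_right (moreAgents.cost + copyEntry.maxCost + 1) hn
    omega

end MatchingInstance

theorem mainTheorem3 :
    -- existence, for arbitrary finite sets of agents and objects
    (∀ (A O : Type*) [Finite A] [Finite O] (I : MatchingInstance A O), I.StrictRankings →
      ∃ S : Set (Set (A × O)), S.encard ≤ 2 ∧ I.IsStronglyPopular S) ∧
    -- one program computes such a set `{M₁, M₂}` (with `M₁ = M₂` allowed) in polynomial time for all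
    -- instances, given an independence oracle, and reports whether a top-choice matching exists
    (∃ (p : OracleRAM.Program) (T : Polynomial ℕ),
      ∀ (n m : ℕ) (I : MatchingInstance (Fin n) (Fin m)), I.StrictRankings →
        ∃ (t : ℕ) (s : OracleRAM.Memory) (M₁ M₂ : Set (Fin n × Fin m)),
          OracleRAM.Run I.oracle p I.input t s ∧ t ≤ T.eval (n + m) ∧
          MatchingInstance.Represents s 3 M₁ ∧ MatchingInstance.Represents s 4 M₂ ∧
          I.IsStronglyPopular {M₁, M₂} ∧
          ((∃ M, I.IsTopChoice M) → M₁ = M₂ ∧ I.IsTopChoice M₁ ∧ s 5 0 = 1) ∧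
          ((¬ ∃ M, I.IsTopChoice M) → s 5 0 = 0)) := by
  refine ⟨fun A O _ _ I hI => MatchingInstance.exists_isStronglyPopular hI, ?_⟩
  obtain ⟨T, hT⟩ := MatchingInstance.exists_polynomial_greedyTime
  refine ⟨OracleRAM.greedyProgram, T, fun n m I hI => ?_⟩
  obtain ⟨t, s, hr, ht, M₁, M₂, h⟩ := MatchingInstance.halts_greedyProgram hI
  exact ⟨t, s, M₁, M₂, hr, ht.trans (hT n m), h⟩
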